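/- Let $d,N\ge 0$ be integers and fix the statistics (bosons or fermions). Let $\mathfrak H=L^2(\mathbb R^d)$, and let $\mathfrak H^n\subset L^2((\mathbb R^d)^n)$ be the closed subspace of symmetric (bosons) or antisymmetric (fermions) functions, with $\mathfrak H^0=\mathbb C$. Let $\mathcal F^{\le N}=\bigoplus_{n=0}^N\mathfrak H^n$ (Hilbert space direct sum) be the truncated Fock space, and let $\mathcal S(\mathcal F^{\le N})$ be the set of states on it, that is, of nonnegative self-adjoint trace-class operators $\Gamma$ with $\operatorname{tr}\Gamma=1$. For $f\in\mathfrak H$ let $a^\dagger(f)$ be the creation operator, $a^\dagger(f)\psi=f\circ\psi$ for $\psi\in\mathfrak H^n$, where $$(f\circ\psi)(x_1,\dots,x_{n+1})=\frac1{\sqrt{n!\,(n+1)!}}\sum_{\sigma\in S_{n+1}}\chi(\sigma)\,f(x_{\sigma(1)})\,\psi(x_{\sigma(2)},\dots,x_{\sigma(n+1)}),$$ with $\chi=1$ for bosons and $\chi=\operatorname{sgn}$ for fermions, and let $a(f)$ be its adjoint, the annihilation operator. For $\Gamma\in\mathcal S(\mathcal F^{\le N})$, extended by zero to the whole Fock space,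 and $0\le p,q\le N$, the density matrix $[\Gamma]^{(p,q)}:\mathfrak H^q\to\mathfrak H^p$ is the bounded operator determined by $$\langle g_1\circ\cdots\circ g_p,\,[\Gamma]^{(p,q)}f_1\circ\cdots\circ f_q\rangle=\operatorname{tr}\big(\Gamma\,a^\dagger(f_1)\cdots a^\dagger(f_q)\,a(g_p)\cdots a(g_1)\big)\qquad\text{for all } f_i,g_j\in\mathfrak H$$ (an empty product of vectors is the vacuum $1\in\mathfrak H^0$). The geometric topology on $\mathcal S(\mathcal F^{\le N})$ is the coarsest one for which all the maps $\Gamma\mapsto\langle\psi,[\Gamma]^{(p,q)}\psi'\rangle$, with $0\le p,q\le N$, $\psi\in\mathfrak H^p$, $\psi'\in\mathfrak H^q$, are continuous; $\Gamma_n\to\Gamma$ geometrically means that $\langle\psi,[\Gamma_n]^{(p,q)}\psi'\rangle\to\langle\psi,[\Gamma]^{(p,q)}\psi'\rangle$ for all these $p,q,\psi,\psi'$. Then for every state $\Gamma$ and all $0\le p,q\le N$ the density matrix $[\Gamma]^{(p,q)}$ exists and is unique, and the set $\mathcal S(\mathcal F^{\le N})$ is compact and sequentially compact for the geometric topology. In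 particular, every sequence $(\Gamma_n)$ of states on $\mathcal F^{\le N}$ has a subsequence $(\Gamma_{n_k})$ that converges geometrically to a state $\Gamma$ on $\mathcal F^{\le N}$ (so that $\operatorname{tr}\Gamma=1$). Moreover, for all $0\le p,q\le N$, the operators $[\Gamma_{n_k}]^{(p,q)}$ and $[\Gamma]^{(p,q)}$ are trace class and $[\Gamma_{n_k}]^{(p,q)}\to[\Gamma]^{(p,q)}$ weakly-$*$ in the trace class: $\operatorname{tr}([\Gamma_{n_k}]^{(p,q)}K)\to\operatorname{tr}([\Gamma]^{(p,q)}K)$ for every compact operator $K:\mathfrak H^p\to\mathfrak H^q$. -/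

import Mathlib

open MeasureTheory Filter Topology
open scoped InnerProductSpace

noncomputable section

namespace GeomFock

/-! ### Traces and trace-class operators on complex Hilbert spaces -/

section Trace

universe u v

variable {X : Type u} [NormedAddCommGroup X] [InnerProductSpace ℂ X] [CompleteSpace X]
  {Y : Type v} [NormedAddCommGroup Y] [InnerProductSpace ℂ Y] [CompleteSpace Y]

/-- `HasTrace T t`: for every orthonormal basis `(b i)` of `X`, the series `∑ ⟪b i, T (b i)⟫`
converges unconditionally, with sum `t`. -/
def HasTrace (T : X → X) (t : ℂ) : Prop :=
  ∀ (ι : Type u) (b : HilbertBasis ι ℂ X), HasSum (fun i => ⟪b i, T (b i)⟫_ℂ) t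

/-- The absolute value `|T| = √(T* T)` of a bounded operator between Hilbert spaces. -/
def opAbs (T : X →L[ℂ] Y) : X →L[ℂ] X :=
  CFC.sqrt (ContinuousLinearMap.adjoint T ∘L T)

/-- `T` is trace class: `tr |T| < ∞`. -/
def IsTraceClass (T : X →L[ℂ] Y) : Prop :=
  ∃ t : ℂ, HasTrace (opAbs T) t

/-- Weak-* convergence of a sequence of operators `X → Y` in the trace class, the trace class
being the dual of the compact operators `K : Y → X` through the pairing `tr (T K)`. -/
def WeakStarTendsto (T : ℕ → X →L[ℂ] Y) (T₀ : X →L[ℂ] Y) : Prop :=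
  (∀ n, IsTraceClass (T n)) ∧ IsTraceClass T₀ ∧
    ∀ K : Y →L[ℂ] X, IsCompactOperator K →
      ∃ (t : ℕ → ℂ) (t₀ : ℂ), (∀ n, HasTrace (T n ∘L K) (t n)) ∧ HasTrace (T₀ ∘L K) t₀ ∧
        Tendsto t atTop (𝓝 t₀)

end Trace

/-! ### Spaces of indistinguishable particles -/

/-- The two kinds of statistics. -/
inductive Statistics
  | boson
  | fermion

/-- The character of the symmetric group that belongs to the statistics: trivial for bosons,
the signature for fermions. -/
def Statistics.char (s : Statistics) {n : ℕ} : Equiv.Perm (Fin n) →* ℤˣ :=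
  match s with
  | .boson => 1
  | .fermion => Equiv.Perm.sign

/-- The one-body space `L²(ℝᵈ)`. -/
abbrev OneBody (d : ℕ) : Type :=
  Lp ℂ 2 (volume : Measure (EuclideanSpace ℝ (Fin d)))

/-- The space `L²((ℝᵈ)ⁿ)`; for `n = 0` the domain is one point of mass one. -/
abbrev L2n (d n : ℕ) : Type :=
  Lp ℂ 2 (volume : Measure (Fin n → EuclideanSpace ℝ (Fin d)))

lemma measurePreserving_perm (d n : ℕ) (σ : Equiv.Perm (Fin n)) :
    MeasurePreserving (fun x : Fin n → EuclideanSpace ℝ (Fin d) => fun i => x (σ i)) := by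
  have h := volume_measurePreserving_piCongrLeft
    (fun _ : Fin n => EuclideanSpace ℝ (Fin d)) σ.symm
  have e : (fun x : Fin n → EuclideanSpace ℝ (Fin d) => fun i => x (σ i)) =
      MeasurableEquiv.piCongrLeft (fun _ : Fin n => EuclideanSpace ℝ (Fin d)) σ.symm := by
    funext x i
    simp [MeasurableEquiv.piCongrLeft, Equiv.piCongrLeft_apply]
  rw [e]
  exact h

/-- `(permute σ ψ)(x₁, …, xₙ) = ψ(x_{σ(1)}, …, x_{σ(n)})`. -/
def permute {d n : ℕ} (σ : Equiv.Perm (Fin n)) : L2n d n →ₗᵢ[ℂ] L2n d n :=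
  Lp.compMeasurePreservingₗᵢ ℂ _ (measurePreserving_perm d n σ)

lemma permute_mul {d n : ℕ} (σ τ : Equiv.Perm (Fin n)) (ψ : L2n d n) :
    permute τ (permute σ ψ) = permute (τ * σ) ψ := by
  have := Lp.compMeasurePreserving_comp_apply (p := 2) ψ
    (measurePreserving_perm d n σ) (measurePreserving_perm d n τ)
  exact this.symm

/-- The space `L²_{a/s}((ℝᵈ)ⁿ)` of symmetric (bosons), antisymmetric (fermions) wavefunctions. -/
def nBody (s : Statistics) (d n : ℕ) : Submodule ℂ (L2n d n) where
  carrier := {ψ | ∀ σ : Equiv.Perm (Fin n), permute σ ψ = ((s.char σ : ℤ) : ℂ) • ψ}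
  add_mem' {a b} ha hb σ := by rw [map_add, ha σ, hb σ, smul_add]
  zero_mem' σ := by simp
  smul_mem' c a ha σ := by rw [map_smul, ha σ, smul_comm]

lemma isClosed_nBody (s : Statistics) (d n : ℕ) : IsClosed (nBody s d n : Set (L2n d n)) := by
  have : (nBody s d n : Set (L2n d n)) =
      ⋂ σ : Equiv.Perm (Fin n), {ψ | permute σ ψ = ((s.char σ : ℤ) : ℂ) • ψ} := by
    ext ψ; simp [nBody]
  rw [this]
  exact isClosed_iInter fun σ =>
    isClosed_eq (permute σ).continuous (continuous_const_smul _)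

instance (s : Statistics) (d n : ℕ) : CompleteSpace (nBody s d n) :=
  (isClosed_nBody s d n).completeSpace_coe

/-- The truncated Fock space: the Hilbert space direct sum of the `n`-body spaces, `0 ≤ n ≤ N`. -/
abbrev TruncFock (s : Statistics) (d N : ℕ) : Type :=
  PiLp 2 (fun n : Fin (N + 1) => nBody s d n)

/-- All sequences `(ψ⁰, ψ¹, ψ², …)` with `ψⁿ` in the `n`-body space. The Fock space consists of the
square-summable ones, and the finite-particle vectors are those with finitely many nonzero terms. -/
abbrev FockSeq (s : Statistics) (d : ℕ) : Type :=
  ∀ n : ℕ, nBody s d n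

/-- The inclusion of the truncated Fock space: extension by zero to more than `N` particles. -/
def TruncFock.incl {s : Statistics} {d N : ℕ} : TruncFock s d N →ₗ[ℂ] FockSeq s d where
  toFun Φ n := if h : n ≤ N then Φ ⟨n, Nat.lt_succ_of_le h⟩ else 0
  map_add' Φ Ψ := by funext n; by_cases h : n ≤ N <;> simp [h]
  map_smul' c Φ := by funext n; by_cases h : n ≤ N <;> simp [h]

/-- The projection onto the truncated Fock space: the sectors with more than `N` particles are
dropped. -/
def TruncFock.proj {s : Statistics} {d N : ℕ} : FockSeq s d →ₗ[ℂ] TruncFock s d N where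
  toFun Φ := WithLp.toLp 2 (fun n : Fin (N + 1) => Φ n)
  map_add' _ _ := rfl
  map_smul' _ _ := rfl

/-! ### Creation and annihilation operators -/

lemma measurePreserving_cons (d n : ℕ) :
    MeasurePreserving
      (fun x : Fin (n + 1) → EuclideanSpace ℝ (Fin d) => (x 0, fun i : Fin n => x i.succ)) := by
  exact volume_preserving_piFinSuccAbove (fun _ : Fin (n + 1) => EuclideanSpace ℝ (Fin d)) 0

lemma eLpNorm_tensor (d n : ℕ) (f : OneBody d) (ψ : L2n d n) :
    eLpNorm (fun x : Fin (n + 1) → EuclideanSpace ℝ (Fin d) =>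
        f (x 0) * ψ (fun i : Fin n => x i.succ)) 2 volume =
      eLpNorm f 2 volume * eLpNorm ψ 2 volume := by
  have hf := Lp.aestronglyMeasurable f
  have hψ := Lp.aestronglyMeasurable ψ
  have hm : AEStronglyMeasurable
      (fun z : EuclideanSpace ℝ (Fin d) × (Fin n → EuclideanSpace ℝ (Fin d)) =>
        f z.1 * ψ z.2) (volume.prod volume) := hf.comp_fst.mul hψ.comp_snd
  have h1 := eLpNorm_comp_measurePreserving (p := 2) hm (measurePreserving_cons d n)
  refine h1.trans ?_
  simp only [eLpNorm_eq_lintegral_rpow_enorm_toReal (p := 2) (by simp) (by simp)]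
  rw [← ENNReal.mul_rpow_of_nonneg _ _ (by simp),
    ← lintegral_prod_mul (hf.enorm.pow_const _) (hψ.enorm.pow_const _)]
  simp [enorm_mul, mul_pow]

lemma memLp_tensor (d n : ℕ) (f : OneBody d) (ψ : L2n d n) :
    MemLp (fun x : Fin (n + 1) → EuclideanSpace ℝ (Fin d) =>
        f (x 0) * ψ (fun i : Fin n => x i.succ)) 2 volume := by
  refine ⟨?_, ?_⟩
  · have hm : AEStronglyMeasurable
      (fun z : EuclideanSpace ℝ (Fin d) × (Fin n → EuclideanSpace ℝ (Fin d)) =>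
        f z.1 * ψ z.2) (volume.prod volume) :=
      (Lp.aestronglyMeasurable f).comp_fst.mul (Lp.aestronglyMeasurable ψ).comp_snd
    exact hm.comp_measurePreserving (measurePreserving_cons d n)
  · rw [eLpNorm_tensor]
    exact ENNReal.mul_lt_top (Lp.eLpNorm_lt_top f) (Lp.eLpNorm_lt_top ψ)

/-- The tensor product `(f ⊗ ψ)(x₀, …, xₙ) = f(x₀) ψ(x₁, …, xₙ)`. -/
def tensor {d n : ℕ} (f : OneBody d) (ψ : L2n d n) : L2n d (n + 1) :=
  (memLp_tensor d n f ψ).toLp _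

lemma norm_tensor {d n : ℕ} (f : OneBody d) (ψ : L2n d n) : ‖tensor f ψ‖ = ‖f‖ * ‖ψ‖ := by
  rw [tensor, Lp.norm_toLp, eLpNorm_tensor, ENNReal.toReal_mul, Lp.norm_def, Lp.norm_def]

lemma tensor_ae {d n : ℕ} {ψ : L2n d n} {g : (Fin n → EuclideanSpace ℝ (Fin d)) → ℂ}
    (h : ψ =ᵐ[volume] g) :
    ∀ᵐ x : Fin (n + 1) → EuclideanSpace ℝ (Fin d),
      ψ (fun i : Fin n => x i.succ) = g (fun i : Fin n => x i.succ) :=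
  ((Measure.quasiMeasurePreserving_snd (μ := volume) (ν := volume)).comp
    (measurePreserving_cons d n).quasiMeasurePreserving).ae h

/-- `ψ ↦ f ⊗ ψ` as a bounded operator. -/
def tensorL (d n : ℕ) (f : OneBody d) : L2n d n →L[ℂ] L2n d (n + 1) :=
  LinearMap.mkContinuous
    { toFun := tensor f
      map_add' := fun ψ φ => by
        apply Lp.ext
        filter_upwards [(memLp_tensor d n f (ψ + φ)).coeFn_toLp,
          Lp.coeFn_add (tensor f ψ) (tensor f φ), (memLp_tensor d n f ψ).coeFn_toLp,
          (memLp_tensor d n f φ).coeFn_toLp, tensor_ae (Lp.coeFn_add ψ φ)] with x h1 h2 h3 h4 h5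
        rw [h2, Pi.add_apply]
        unfold tensor
        rw [h1, h3, h4, h5, Pi.add_apply, mul_add]
      map_smul' := fun c ψ => by
        apply Lp.ext
        filter_upwards [(memLp_tensor d n f (c • ψ)).coeFn_toLp,
          Lp.coeFn_smul c (tensor f ψ), (memLp_tensor d n f ψ).coeFn_toLp,
          tensor_ae (Lp.coeFn_smul c ψ)] with x h1 h2 h3 h5
        rw [RingHom.id_apply, h2, Pi.smul_apply]
        unfold tensor
        rw [h1, h3, h5, Pi.smul_apply, smul_eq_mul, smul_eq_mul]
        ring }
    ‖f‖ (fun ψ => (norm_tensor f ψ).le)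

/-- The (anti)symmetrised sum `∑_σ χ(σ) Φ(x_{σ(1)}, …, x_{σ(n)})`, where `χ` is the signature for
fermions and `1` for bosons. -/
def symSum (s : Statistics) (d n : ℕ) : L2n d n →L[ℂ] L2n d n :=
  ∑ σ : Equiv.Perm (Fin n), ((s.char σ : ℤ) : ℂ) • (permute σ).toContinuousLinearMap

lemma symSum_mem (s : Statistics) (d n : ℕ) (Φ : L2n d n) : symSum s d n Φ ∈ nBody s d n := by
  intro τ
  simp only [symSum, sum_apply, smul_apply,
    LinearIsometry.coe_toContinuousLinearMap, map_sum, map_smul, permute_mul, Finset.smul_sum]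
  rw [← Equiv.sum_comp (Equiv.mulLeft τ) (fun σ => ((s.char τ : ℤ) : ℂ) •
    ((s.char σ : ℤ) : ℂ) • permute σ Φ)]
  refine Finset.sum_congr rfl fun σ _ => ?_
  rw [Equiv.coe_mulLeft, smul_smul, map_mul]
  congr 1
  push_cast
  rw [← mul_assoc]
  norm_cast
  rw [Int.units_mul_self, one_mul]

/-- Creation of a particle, from `n` to `n + 1` particles: `f ∧ ψ` (fermions), `f ∨ ψ` (bosons),
that is
`(n! (n+1)!)^{-1/2} ∑_σ χ(σ) f(x_{σ(1)}) ψ(x_{σ(2)}, …, x_{σ(n+1)})`. -/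
def create (s : Statistics) (d n : ℕ) (f : OneBody d) : nBody s d n →L[ℂ] nBody s d (n + 1) :=
  ((((Real.sqrt (n.factorial * (n + 1).factorial))⁻¹ : ℝ) : ℂ) •
    (symSum s d (n + 1) ∘L tensorL d n f ∘L (nBody s d n).subtypeL)).codRestrict _
    (fun _ => Submodule.smul_mem _ _ (symSum_mem s d (n + 1) _))

/-- Annihilation of a particle, from `n + 1` to `n` particles: the adjoint of creation. -/
def annihilate (s : Statistics) (d n : ℕ) (f : OneBody d) :
    nBody s d (n + 1) →L[ℂ] nBody s d n :=
  ContinuousLinearMap.adjoint (create s d n f)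

/-- The creation operator `a†(f)`. -/
def aDag {s : Statistics} {d : ℕ} (f : OneBody d) : FockSeq s d →ₗ[ℂ] FockSeq s d where
  toFun Φ
    | 0 => 0
    | n + 1 => create s d n f (Φ n)
  map_add' Φ Ψ := by funext n; cases n <;> simp
  map_smul' c Φ := by funext n; cases n <;> simp

/-- The annihilation operator `a(f)`. -/
def aOp {s : Statistics} {d : ℕ} (f : OneBody d) : FockSeq s d →ₗ[ℂ] FockSeq s d where
  toFun Φ n := annihilate s d n f (Φ (n + 1))
  map_add' Φ Ψ := by funext n; simp
  map_smul' c Φ := by funext n; simp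

/-- `a†(f₁) ⋯ a†(f_q)`. -/
def creationString {s : Statistics} {d : ℕ} :
    (q : ℕ) → (Fin q → OneBody d) → (FockSeq s d →ₗ[ℂ] FockSeq s d)
  | 0, _ => LinearMap.id
  | q + 1, f => aDag (f 0) ∘ₗ creationString q (fun i => f i.succ)

/-- `a(g_p) ⋯ a(g₁)`. -/
def annihilationString {s : Statistics} {d : ℕ} :
    (p : ℕ) → (Fin p → OneBody d) → (FockSeq s d →ₗ[ℂ] FockSeq s d)
  | 0, _ => LinearMap.id
  | p + 1, g => annihilationString p (fun i => g i.succ) ∘ₗ aOp (g 0)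

/-- The vacuum, the function `1` in the zero-body space `L²(point) = ℂ`. -/
def vacuum (s : Statistics) (d : ℕ) : nBody s d 0 :=
  ⟨indicatorConstLp 2 (μ := (volume : Measure (Fin 0 → EuclideanSpace ℝ (Fin d))))
      MeasurableSet.univ (by simp [volume_pi]) (1 : ℂ), by
    intro σ
    have hσ : σ = 1 := Subsingleton.elim _ _
    subst hσ
    rw [map_one, Units.val_one, Int.cast_one, one_smul]
    exact Lp.compMeasurePreserving_id_apply _⟩

/-- The product `f₁ ∘ ⋯ ∘ f_q` in the `q`-body space, where `∘` is `∧` for fermions and `∨` for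
bosons; it is the vacuum for `q = 0`. -/
def prodVec (s : Statistics) (d : ℕ) : (q : ℕ) → (Fin q → OneBody d) → nBody s d q
  | 0, _ => vacuum s d
  | q + 1, f => create s d q (f 0) (prodVec s d q (fun i => f i.succ))

/-! ### States, density matrices, geometric convergence -/

/-- A (mixed) state on the truncated Fock space: a nonnegative self-adjoint trace-class operator of
trace one (for a nonnegative operator, to be trace class is to have a finite trace). -/
structure State (s : Statistics) (d N : ℕ) where
  /-- the operator -/
  op : TruncFock s d N →L[ℂ] TruncFock s d N
  isPositive : ContinuousLinearMap.IsPositive (𝕜 := ℂ) (E := TruncFock s d N) op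
  hasTrace_one : HasTrace op 1

/-- `D` is the `(p,q)` density matrix of `Γ`: the bounded operator from the `q`-body space to the
`p`-body space such that
`⟪g₁ ∘ ⋯ ∘ g_p, D (f₁ ∘ ⋯ ∘ f_q)⟫ = tr (Γ a†(f₁) ⋯ a†(f_q) a(g_p) ⋯ a(g₁))`.
The trace may be taken over the truncated Fock space, as `Γ` is extended by zero to the rest of
the Fock space. -/
def IsDensityMatrix {s : Statistics} {d N : ℕ} (Γ : State s d N) (p q : ℕ)
    (D : nBody s d q →L[ℂ] nBody s d p) : Prop :=
  ∀ (f : Fin q → OneBody d) (g : Fin p → OneBody d),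
    HasTrace
      (fun Φ : TruncFock s d N => Γ.op (TruncFock.proj
        (creationString q f (annihilationString p g (TruncFock.incl Φ)))))
      ⟪prodVec s d p g, D (prodVec s d q f)⟫_ℂ

open scoped Classical in
/-- The density matrix `[Γ]^{(p,q)}` (the value `0` in the second case is never used, since there is
always exactly one density matrix). -/
def densityMatrix {s : Statistics} {d N : ℕ} (Γ : State s d N) (p q : ℕ) :
    nBody s d q →L[ℂ] nBody s d p :=
  if h : ∃ D, IsDensityMatrix Γ p q D then h.choose else 0

/-- The geometric topology on states: the coarsest topology for which all the maps
`Γ ↦ ⟪ψ, [Γ]^{(p,q)} ψ'⟫`, `0 ≤ p, q ≤ N`, are continuous. -/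
@[reducible] def geometricTopology (s : Statistics) (d N : ℕ) : TopologicalSpace (State s d N) :=
  ⨅ (p : Fin (N + 1)) (q : Fin (N + 1)) (ψ : nBody s d p) (ψ' : nBody s d q),
    TopologicalSpace.induced (fun Γ => ⟪ψ, densityMatrix Γ p q ψ'⟫_ℂ) inferInstance

/-- Geometric convergence of a sequence of states. -/
def GeomTendsto {s : Statistics} {d N : ℕ} (Γ : ℕ → State s d N) (Γ₀ : State s d N) : Prop :=
  ∀ p ≤ N, ∀ q ≤ N, ∀ (ψ : nBody s d p) (ψ' : nBody s d q),
    Tendsto (fun n => ⟪ψ, densityMatrix (Γ n) p q ψ'⟫_ℂ) atTop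
      (𝓝 ⟪ψ, densityMatrix Γ₀ p q ψ'⟫_ℂ)

end GeomFock

end

/-!
# Geometric compactness of the set of states on a truncated Fock space

Density matrices. Write a state as `Γ = ∑ |ξ a⟩⟨ξ a|`. Inserting a resolution of the identity between
the creation and the annihilation operators of `tr (Γ a†(f₁) ⋯ a†(f_q) a(g_p) ⋯ a(g₁))`, and using that
annihilation operators (anti)commute, exhibits the density matrix as a sum of rank-one operators
`|v⟩⟨u|`, with vectors obtained from `ξ a` by removing particles (`exists_partialTrace`). As there are at
most `N` particles, the sums of the squares of the norms of the `u` and of the `v` are bounded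
independently of the state. Such a nuclear representation (`NuclearRep`) yields the trace class property
and the traces of products, and it reduces weak-* convergence to the convergence of the matrix elements
(`weakStarTendsto_of_tendsto_inner`).

Compactness. Let `A_f` be the truncation to at most `N` particles of `a(f_q) ⋯ a(f₁)`. The expectation
values `X ↦ tr (Γ X)` are positive normalised functionals on the bounded operators on the truncated Fock
space, and along an ultrafilter of states they converge to such a functional `ω`. In general `ω` is not
given by a trace, because particles may escape to infinity, so a state is needed that has the same values
on the products `A_f† A_g` alone. Let `π` be the Gelfand–Naimark–Segal representation of `ω`, with cyclic
vector `Ψ`. Call a vector with a definite number `l` of particles a generalized vacuum if `π (a(f))`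
vanishes on it for all `f`. The canonical (anti)commutation relations hold below the highest sector, and
therefore each unit generalized vacuum generates isometric copies of the sectors with at most `N - l`
particles. Since the number of particles is bounded, removing particles from a vector ends after finitely
many steps, and so the generalized vacua generate the whole space. Thus there are maps `Ξ j` from the
representation space to the truncated Fock space that satisfy Parseval's identity and intertwine the
annihilation operators (`exists_intertwiners`), and
`⟪A_f (Ξ j Ψ), A_g (Ξ j Ψ)⟫ = ⟪Ξ j (π A_f Ψ), Ξ j (π A_g Ψ)⟫` sums up to `ω (A_f† A_g)`. Hence
`∑ |Ξ j Ψ⟩⟨Ξ j Ψ|` is the limit state (`exists_state_of_rep`); its trace is `‖Ψ‖ ^ 2 = 1`, as the escaped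
particles are traced out and no mass is lost.

Matrix elements between product vectors extend to all vectors by density and the uniform bound. Since the
`n`-body spaces are separable, the geometric topology is first countable, so that compactness implies
sequential compactness.
-/

noncomputable section

namespace GeomFock

set_option linter.unusedSectionVars false

/-! ### Isometries and Parseval's identity -/

section Hilbert

open ContinuousLinearMap

/-- A linear map that preserves norms relative to a map with dense range extends to an isometry. -/
lemma exists_linearIsometry_of_norm_eq {M E F : Type*} [AddCommGroup M] [Module ℂ M]
    [NormedAddCommGroup E] [InnerProductSpace ℂ E] [NormedAddCommGroup F] [InnerProductSpace ℂ F]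
    [CompleteSpace F] (e : M →ₗ[ℂ] E) (f : M →ₗ[ℂ] F) (he : DenseRange e)
    (h : ∀ x, ‖f x‖ = ‖e x‖) : ∃ U : E →ₗᵢ[ℂ] F, ∀ x, U (e x) = f x := by
  have hU : ∀ x, f.extendOfNorm e (e x) = f x :=
    LinearMap.extendOfNorm_eq he ⟨1, fun x => by rw [h, one_mul]⟩
  refine ⟨⟨(f.extendOfNorm e).toLinearMap, fun x => ?_⟩, hU⟩
  refine he.induction_on (p := fun x => ‖f.extendOfNorm e x‖ = ‖x‖) x ?_ fun x => ?_
  · exact isClosed_eq (by fun_prop) (by fun_prop)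
  · rw [hU, h]

/-- Parseval's identity for a Hilbert space that is the orthogonal sum of the ranges of the
isometries `V i`. -/
lemma hasSum_inner_adjoint {ι : Type*} {E : Type*} [NormedAddCommGroup E] [InnerProductSpace ℂ E]
    [CompleteSpace E] {G : ι → Type*} [∀ i, NormedAddCommGroup (G i)]
    [∀ i, InnerProductSpace ℂ (G i)] [∀ i, CompleteSpace (G i)] (V : ∀ i, G i →ₗᵢ[ℂ] E)
    (hV : OrthogonalFamily ℂ G V)
    (ht : ∀ x, (∀ i, adjoint (V i).toContinuousLinearMap x = 0) → x = 0) (x y : E) :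
    HasSum (fun i => ⟪adjoint (V i).toContinuousLinearMap x,
      adjoint (V i).toContinuousLinearMap y⟫_ℂ) ⟪x, y⟫_ℂ := by
  classical
  have hs : IsHilbertSum ℂ G V := by
    refine IsHilbertSum.mk hV ?_
    rw [← Submodule.orthogonal_orthogonal_eq_closure, ← eq_top_iff, Submodule.orthogonal_eq_top_iff,
      Submodule.eq_bot_iff]
    intro z hz
    refine ht z fun i => ?_
    refine ext_inner_left ℂ fun g => ?_
    rw [adjoint_inner_right, inner_zero_right]
    exact (Submodule.mem_orthogonal _ _).1 hz _
      (Submodule.mem_iSup_of_mem i (LinearMap.mem_range_self _ g))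
  have key : ∀ z i, hs.linearIsometryEquiv z i = adjoint (V i).toContinuousLinearMap z := by
    intro z i
    refine ext_inner_left ℂ fun g => ?_
    rw [adjoint_inner_right, ← lp.inner_single_left]
    rw [← hs.linearIsometryEquiv.symm.inner_map_map, LinearIsometryEquiv.symm_apply_apply,
      hs.linearIsometryEquiv_symm_apply_single]
    rfl
  have := lp.hasSum_inner (𝕜 := ℂ) (hs.linearIsometryEquiv x) (hs.linearIsometryEquiv y)
  rw [LinearIsometryEquiv.inner_map_map] at this
  simpa only [key] using this

end Hilbert

/-! ### Nuclear representations and traces -/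

section Nuclear

open ContinuousLinearMap

universe u v

variable {X : Type u} [NormedAddCommGroup X] [InnerProductSpace ℂ X] [CompleteSpace X]
  {Y : Type v} [NormedAddCommGroup Y] [InnerProductSpace ℂ Y] [CompleteSpace Y] {A : Type*}

/-- `D = ∑ |v a⟩⟨u a|` with square-summable families of vectors `u` and `v`. -/
structure NuclearRep (D : X →L[ℂ] Y) (u : A → X) (v : A → Y) : Prop where
  summable_left : Summable fun a => ‖u a‖ ^ 2
  summable_right : Summable fun a => ‖v a‖ ^ 2
  hasSum : ∀ x, HasSum (fun a => ⟪u a, x⟫_ℂ • v a) (D x)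

lemma mul_le_half_add_sq (x y : ℝ) : x * y ≤ (1 / 2) * (x ^ 2 + y ^ 2) := by
  nlinarith [sq_nonneg (x - y)]

lemma summable_norm_mul_norm {u : A → X} {v : A → Y} (hu : Summable fun a => ‖u a‖ ^ 2)
    (hv : Summable fun a => ‖v a‖ ^ 2) : Summable fun a => ‖u a‖ * ‖v a‖ :=
  .of_nonneg_of_le (fun _ => by positivity) (fun a => mul_le_half_add_sq ‖u a‖ ‖v a‖)
    ((hu.add hv).mul_left (1 / 2))

lemma tsum_norm_mul_norm_le {u : A → X} {v : A → Y} (hu : Summable fun a => ‖u a‖ ^ 2)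
    (hv : Summable fun a => ‖v a‖ ^ 2) {C : ℝ} (hu' : ∑' a, ‖u a‖ ^ 2 ≤ C)
    (hv' : ∑' a, ‖v a‖ ^ 2 ≤ C) : ∑' a, ‖u a‖ * ‖v a‖ ≤ C := by
  have h := (summable_norm_mul_norm hu hv).tsum_le_tsum (fun a => mul_le_half_add_sq ‖u a‖ ‖v a‖)
    ((hu.add hv).mul_left (1 / 2))
  rw [tsum_mul_left, hu.tsum_add hv] at h
  linarith

/-- Square-summable families of vectors define a nuclear operator, the series of the rank-one
operators being absolutely convergent. -/
lemma exists_nuclearRep {u : A → X} {v : A → Y} (hu : Summable fun a => ‖u a‖ ^ 2)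
    (hv : Summable fun a => ‖v a‖ ^ 2) : ∃ D : X →L[ℂ] Y, NuclearRep D u v := by
  have hs : Summable fun a => InnerProductSpace.rankOne ℂ (v a) (u a) := by
    refine .of_norm ?_
    simpa [mul_comm] using summable_norm_mul_norm hu hv
  refine ⟨∑' a, InnerProductSpace.rankOne ℂ (v a) (u a), hu, hv, fun x => ?_⟩
  simpa using (ContinuousLinearMap.apply ℂ Y x).hasSum hs.hasSum

lemma summable_pairing {u : A → X} {v : A → Y} (hu : Summable fun a => ‖u a‖ ^ 2)
    (hv : Summable fun a => ‖v a‖ ^ 2) (K : Y →L[ℂ] X) :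
    Summable fun a => ‖⟪u a, K (v a)⟫_ℂ‖ := by
  refine .of_nonneg_of_le (fun _ => by positivity) (fun a => ?_)
    ((summable_norm_mul_norm hu hv).mul_left ‖K‖)
  calc ‖⟪u a, K (v a)⟫_ℂ‖ ≤ ‖u a‖ * ‖K (v a)‖ := norm_inner_le_norm _ _
    _ ≤ ‖u a‖ * (‖K‖ * ‖v a‖) := by gcongr; exact K.le_opNorm _
    _ = ‖K‖ * (‖u a‖ * ‖v a‖) := by ring

/-- The functional `K ↦ tr (D K)` for `D = ∑ |v a⟩⟨u a|`. -/
def nuclearPairing {u : A → X} {v : A → Y} (hu : Summable fun a => ‖u a‖ ^ 2)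
    (hv : Summable fun a => ‖v a‖ ^ 2) : (Y →L[ℂ] X) →ₗ[ℂ] ℂ where
  toFun K := ∑' a, ⟪u a, K (v a)⟫_ℂ
  map_add' K L := by
    simp only [add_apply, inner_add_right]
    exact (summable_pairing hu hv K).of_norm.tsum_add (summable_pairing hu hv L).of_norm
  map_smul' c K := by
    simp only [smul_apply, inner_smul_right, RingHom.id_apply, smul_eq_mul]
    exact tsum_mul_left

lemma nuclearPairing_apply {u : A → X} {v : A → Y} (hu : Summable fun a => ‖u a‖ ^ 2)
    (hv : Summable fun a => ‖v a‖ ^ 2) (K : Y →L[ℂ] X) :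
    nuclearPairing hu hv K = ∑' a, ⟪u a, K (v a)⟫_ℂ := rfl

lemma norm_nuclearPairing_le {u : A → X} {v : A → Y} (hu : Summable fun a => ‖u a‖ ^ 2)
    (hv : Summable fun a => ‖v a‖ ^ 2) {C : ℝ} (hu' : ∑' a, ‖u a‖ ^ 2 ≤ C)
    (hv' : ∑' a, ‖v a‖ ^ 2 ≤ C) (K : Y →L[ℂ] X) : ‖nuclearPairing hu hv K‖ ≤ C * ‖K‖ := by
  calc ‖nuclearPairing hu hv K‖ ≤ ∑' a, ‖⟪u a, K (v a)⟫_ℂ‖ :=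
        norm_tsum_le_tsum_norm (summable_pairing hu hv K)
    _ ≤ ∑' a, ‖K‖ * (‖u a‖ * ‖v a‖) := by
        refine (summable_pairing hu hv K).tsum_le_tsum (fun a => ?_)
          ((summable_norm_mul_norm hu hv).mul_left ‖K‖)
        calc ‖⟪u a, K (v a)⟫_ℂ‖ ≤ ‖u a‖ * ‖K (v a)‖ := norm_inner_le_norm _ _
          _ ≤ ‖u a‖ * (‖K‖ * ‖v a‖) := by gcongr; exact K.le_opNorm _
          _ = ‖K‖ * (‖u a‖ * ‖v a‖) := by ring
    _ ≤ C * ‖K‖ := by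
        rw [tsum_mul_left, mul_comm]
        gcongr
        exact tsum_norm_mul_norm_le hu hv hu' hv'

namespace NuclearRep

variable {D : X →L[ℂ] Y} {u : A → X} {v : A → Y}

lemma inner_hasSum (h : NuclearRep D u v) (x : X) (y : Y) :
    HasSum (fun a => ⟪u a, x⟫_ℂ * ⟪y, v a⟫_ℂ) ⟪y, D x⟫_ℂ := by
  simpa [inner_smul_right] using (innerSL ℂ y).hasSum (h.hasSum x)

lemma norm_inner_le (h : NuclearRep D u v) {C : ℝ} (hu : ∑' a, ‖u a‖ ^ 2 ≤ C)
    (hv : ∑' a, ‖v a‖ ^ 2 ≤ C) (x : X) (y : Y) : ‖⟪y, D x⟫_ℂ‖ ≤ C * ‖x‖ * ‖y‖ := by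
  have hs := (summable_norm_mul_norm h.summable_left h.summable_right).mul_left (‖x‖ * ‖y‖)
  have hb : ∀ a, ‖⟪u a, x⟫_ℂ * ⟪y, v a⟫_ℂ‖ ≤ ‖x‖ * ‖y‖ * (‖u a‖ * ‖v a‖) := fun a => by
    rw [norm_mul]
    calc _ ≤ (‖u a‖ * ‖x‖) * (‖y‖ * ‖v a‖) := by
          gcongr <;> exact norm_inner_le_norm _ _
      _ = _ := by ring
  rw [← (h.inner_hasSum x y).tsum_eq]
  refine (tsum_of_norm_bounded hs.hasSum hb).trans ?_
  rw [tsum_mul_left]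
  have := tsum_norm_mul_norm_le h.summable_left h.summable_right hu hv
  calc ‖x‖ * ‖y‖ * ∑' a, ‖u a‖ * ‖v a‖ ≤ ‖x‖ * ‖y‖ * C := by gcongr
    _ = _ := by ring

lemma comp_left {Z : Type*} [NormedAddCommGroup Z] [InnerProductSpace ℂ Z]
    (h : NuclearRep D u v) (T : Y →L[ℂ] Z) : NuclearRep (T ∘L D) u (fun a => T (v a)) where
  summable_left := h.summable_left
  summable_right := by
    refine .of_nonneg_of_le (fun _ => by positivity) (fun a => ?_)
      (h.summable_right.mul_left (‖T‖ ^ 2))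
    rw [← mul_pow]
    gcongr
    exact T.le_opNorm _
  hasSum x := by simpa using T.hasSum (h.hasSum x)

lemma comp_right {Z : Type*} [NormedAddCommGroup Z] [InnerProductSpace ℂ Z] [CompleteSpace Z]
    (h : NuclearRep D u v) (T : Z →L[ℂ] X) :
    NuclearRep (D ∘L T) (fun a => adjoint T (u a)) v where
  summable_left := by
    refine .of_nonneg_of_le (fun _ => by positivity) (fun a => ?_)
      (h.summable_left.mul_left (‖adjoint T‖ ^ 2))
    rw [← mul_pow]
    gcongr
    exact (adjoint T).le_opNorm _
  summable_right := h.summable_right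
  hasSum x := by simpa [adjoint_inner_left] using h.hasSum (T x)

end NuclearRep

/-- The double series `∑ ⟪u a, b i⟫ ⟪b i, v a⟫` converges absolutely, and may be summed in either
order: over `i` first by Parseval's identity, or over `a` first by the nuclear representation. -/
lemma NuclearRep.hasTrace {D : X →L[ℂ] X} {u v : A → X} (h : NuclearRep D u v) :
    HasTrace D (∑' a, ⟪u a, v a⟫_ℂ) := by
  intro ι b
  have hsq : ∀ w : A → X, (Summable fun a => ‖w a‖ ^ 2) →
      Summable fun z : A × ι => ‖⟪b z.2, w z.1⟫_ℂ‖ ^ 2 := by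
    intro w hw
    have hp : ∀ a, HasSum (fun i => ‖⟪b i, w a⟫_ℂ‖ ^ 2) (‖w a‖ ^ 2) := fun a => by
      have := (b.hasSum_inner_mul_inner (w a) (w a)).mapL Complex.reCLM
      simp only [Complex.reCLM_apply] at this
      have h2 : (⟪w a, w a⟫_ℂ).re = ‖w a‖ ^ 2 := inner_self_eq_norm_sq (𝕜 := ℂ) (w a)
      rw [h2] at this
      refine this.congr_fun ?_
      intro i
      rw [← inner_conj_symm (w a) (b i), ← Complex.normSq_eq_conj_mul_self, Complex.ofReal_re,
        Complex.normSq_eq_norm_sq]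
    rw [summable_prod_of_nonneg (fun _ => by positivity)]
    refine ⟨fun a => (hp a).summable, ?_⟩
    simpa only [(hp _).tsum_eq] using hw
  have hF : Summable fun z : A × ι => ⟪u z.1, b z.2⟫_ℂ * ⟪b z.2, v z.1⟫_ℂ := by
    refine .of_norm_bounded (((hsq u h.summable_left).add
      (hsq v h.summable_right)).mul_left (1 / 2)) fun z => ?_
    rw [norm_mul, norm_inner_symm]
    exact mul_le_half_add_sq _ _
  have h1 : HasSum (fun a => ⟪u a, v a⟫_ℂ)
      (∑' z : A × ι, ⟪u z.1, b z.2⟫_ℂ * ⟪b z.2, v z.1⟫_ℂ) :=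
    hF.hasSum.prod_fiberwise fun a => b.hasSum_inner_mul_inner (u a) (v a)
  rw [h1.tsum_eq]
  have h2 := (Equiv.prodComm ι A).hasSum_iff.2 hF.hasSum
  exact h2.prod_fiberwise fun i => h.inner_hasSum (b i) (b i)

lemma NuclearRep.hasTrace_comp {D : X →L[ℂ] Y} {u : A → X} {v : A → Y} (h : NuclearRep D u v)
    (K : Y →L[ℂ] X) :
    HasTrace (D ∘L K) (nuclearPairing h.summable_left h.summable_right K) := by
  have := (h.comp_right K).hasTrace
  rw [nuclearPairing_apply]
  simpa only [adjoint_inner_left] using this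

lemma HasTrace.unique {T : X → X} {s t : ℂ} (hs : HasTrace T s) (ht : HasTrace T t) : s = t := by
  obtain ⟨w, b, -⟩ := exists_hilbertBasis ℂ X
  exact (hs w b).unique (ht w b)

lemma nuclearPairing_rankOne {D : X →L[ℂ] Y} {u : A → X} {v : A → Y} (h : NuclearRep D u v)
    (x : X) (y : Y) : nuclearPairing h.summable_left h.summable_right
      (InnerProductSpace.rankOne ℂ x y) = ⟪y, D x⟫_ℂ := by
  rw [nuclearPairing_apply, ← (h.inner_hasSum x y).tsum_eq]
  simp [mul_comm]

lemma opAbs_nonneg (T : X →L[ℂ] Y) : 0 ≤ opAbs T := CFC.sqrt_nonneg _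

lemma adjoint_opAbs (T : X →L[ℂ] Y) : adjoint (opAbs T) = opAbs T :=
  ((nonneg_iff_isPositive _).1 (opAbs_nonneg T)).isSelfAdjoint

lemma opAbs_comp_self (T : X →L[ℂ] Y) : opAbs T ∘L opAbs T = adjoint T ∘L T :=
  CFC.sqrt_mul_sqrt_self _ ((nonneg_iff_isPositive _).2 (isPositive_adjoint_comp_self T))

lemma norm_opAbs_apply (T : X →L[ℂ] Y) (x : X) : ‖T x‖ = ‖opAbs T x‖ := by
  rw [← sq_eq_sq₀ (norm_nonneg _) (norm_nonneg _), ← inner_self_eq_norm_sq (𝕜 := ℂ),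
    ← inner_self_eq_norm_sq (𝕜 := ℂ), ← adjoint_inner_right, ← adjoint_inner_right, adjoint_opAbs]
  have := congrArg (fun S : X →L[ℂ] X => S x) (opAbs_comp_self T)
  simp only [coe_comp, Function.comp_apply] at this
  rw [this]

/-- The part of the polar decomposition `T = V |T|` that is needed: `|T| = W T` for the bounded
operator `W = V*`. -/
lemma exists_adjoint_comp_eq_opAbs (T : X →L[ℂ] Y) :
    ∃ W : Y →L[ℂ] X, W ∘L T = opAbs T := by
  let S : Submodule ℂ X := (LinearMap.range (opAbs T).toLinearMap).topologicalClosure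
  let e : X →ₗ[ℂ] S := (opAbs T).toLinearMap.codRestrict S fun x =>
    Submodule.le_topologicalClosure _ (LinearMap.mem_range_self _ x)
  have he : DenseRange e := by
    intro y
    rw [closure_subtype]
    have := y.2
    rw [← SetLike.mem_coe, Submodule.topologicalClosure_coe] at this
    convert this using 2
    ext z
    simp only [Set.mem_image, Set.mem_range]
    constructor
    · rintro ⟨_, ⟨x, rfl⟩, rfl⟩; exact ⟨x, rfl⟩
    · rintro ⟨x, rfl⟩; exact ⟨e x, ⟨x, rfl⟩, rfl⟩
  obtain ⟨U, hU⟩ := exists_linearIsometry_of_norm_eq e T.toLinearMap he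
    (fun x => norm_opAbs_apply T x)
  have : CompleteSpace S := (Submodule.isClosed_topologicalClosure _).completeSpace_coe
  refine ⟨S.subtypeL ∘L adjoint U.toContinuousLinearMap, ?_⟩
  ext x
  have h : adjoint U.toContinuousLinearMap (T x) = e x := by
    refine ext_inner_left ℂ fun s => ?_
    rw [adjoint_inner_right]
    have := hU x
    change U (e x) = T x at this
    rw [← this]
    exact U.inner_map_map _ _
  simp only [coe_comp, Function.comp_apply, h]
  rfl

/-- If `|D| = W D`, then `|D| = ∑ |W (v a)⟩⟨u a|` has finite trace. -/
lemma NuclearRep.isTraceClass {D : X →L[ℂ] Y} {u : A → X} {v : A → Y} (h : NuclearRep D u v) :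
    IsTraceClass D := by
  obtain ⟨W, hW⟩ := exists_adjoint_comp_eq_opAbs D
  refine ⟨∑' a, ⟪u a, W (v a)⟫_ℂ, ?_⟩
  rw [← hW]
  exact (h.comp_left W).hasTrace

/-- A compact operator is a norm limit of operators of finite rank: the image of the unit ball has a
finite `ε`-net, and one projects onto its span. -/
lemma exists_finiteRank_approx {K : Y →L[ℂ] X} (hK : IsCompactOperator K) {ε : ℝ} (hε : 0 < ε) :
    ∃ (n : ℕ) (x : Fin n → X) (y : Fin n → Y),
      ‖K - ∑ i, InnerProductSpace.rankOne ℂ (x i) (y i)‖ ≤ ε := by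
  have hc : IsCompact (closure (K '' Metric.closedBall 0 1)) :=
    hK.isCompact_closure_image_closedBall 1
  obtain ⟨t, -, htf, ht⟩ := Metric.finite_approx_of_totallyBounded
    (hc.totallyBounded.subset subset_closure) ε hε
  let V : Submodule ℂ X := Submodule.span ℂ t
  have : FiniteDimensional ℂ V := FiniteDimensional.span_of_finite ℂ htf
  let o := stdOrthonormalBasis ℂ V
  refine ⟨_, fun i => (o i : X), fun i => adjoint K (o i), ?_⟩
  have hP : ∀ y, (∑ i, InnerProductSpace.rankOne ℂ (o i : X) (adjoint K (o i))) y =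
      V.starProjection (K y) := by
    intro y
    have h1 := o.sum_repr' (V.orthogonalProjectionOnto (K y))
    have h2 := congrArg (Subtype.val) h1
    rw [Submodule.starProjection_apply, ← h2]
    simp [sum_apply, adjoint_inner_left]
  refine opNorm_le_of_unit_norm hε.le fun y hy => ?_
  have hy' : K y ∈ K '' Metric.closedBall 0 1 := ⟨y, by simp [hy], rfl⟩
  obtain ⟨z, hz, hzy⟩ := Set.mem_iUnion₂.1 (ht hy')
  rw [sub_apply, hP]
  have := V.starProjection_minimal (y := K y)
  have h3 : ‖K y - V.starProjection (K y)‖ ≤ ‖K y - z‖ := by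
    rw [this]
    exact ciInf_le ⟨0, by rintro _ ⟨w, rfl⟩; positivity⟩ (⟨z, Submodule.subset_span hz⟩ : V)
  refine h3.trans ?_
  rw [← dist_eq_norm]
  exact (Metric.mem_ball.1 hzy).le

/-- Weak operator convergence of operators with uniformly bounded nuclear representations implies
weak-* convergence in the trace class. -/
lemma weakStarTendsto_of_tendsto_inner {D : ℕ → X →L[ℂ] Y} {D₀ : X →L[ℂ] Y} {C : ℝ}
    (hD : ∀ n, ∃ (A : Type) (u : A → X) (v : A → Y), NuclearRep (D n) u v ∧
      ∑' a, ‖u a‖ ^ 2 ≤ C ∧ ∑' a, ‖v a‖ ^ 2 ≤ C)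
    (hD₀ : ∃ (A : Type) (u : A → X) (v : A → Y), NuclearRep D₀ u v ∧
      ∑' a, ‖u a‖ ^ 2 ≤ C ∧ ∑' a, ‖v a‖ ^ 2 ≤ C)
    (hlim : ∀ x y, Tendsto (fun n => ⟪y, D n x⟫_ℂ) atTop (𝓝 ⟪y, D₀ x⟫_ℂ)) :
    WeakStarTendsto D D₀ := by
  choose A u v h hu hv using hD
  obtain ⟨A₀, u₀, v₀, h₀, hu₀, hv₀⟩ := hD₀
  refine ⟨fun n => (h n).isTraceClass, h₀.isTraceClass, fun K hK =>
    ⟨fun n => nuclearPairing (h n).summable_left (h n).summable_right K,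
      nuclearPairing h₀.summable_left h₀.summable_right K, fun n => (h n).hasTrace_comp K,
      h₀.hasTrace_comp K, ?_⟩⟩
  have hC : 0 ≤ C := (tsum_nonneg fun _ => by positivity).trans hu₀
  -- Replacing `K` by an operator of finite rank changes all the traces by less than `ε / 3`.
  rw [Metric.tendsto_nhds]
  intro ε hε
  obtain ⟨m, x, y, hxy⟩ := exists_finiteRank_approx hK (ε := ε / (3 * (C + 1))) (by positivity)
  set K' := ∑ i, InnerProductSpace.rankOne ℂ (x i) (y i) with hK'
  have hfin : Tendsto (fun n => nuclearPairing (h n).summable_left (h n).summable_right K') atTop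
      (𝓝 (nuclearPairing h₀.summable_left h₀.summable_right K')) := by
    simp only [hK', map_sum, nuclearPairing_rankOne h₀, fun n => nuclearPairing_rankOne (h n)]
    exact tendsto_finsetSum _ fun i _ => hlim _ _
  have hb : C * ‖K - K'‖ < ε / 3 := by
    calc C * ‖K - K'‖ ≤ C * (ε / (3 * (C + 1))) := by gcongr
      _ < ε / 3 := by
        rw [mul_div_assoc', div_lt_div_iff₀ (by positivity) (by positivity)]
        nlinarith
  filter_upwards [Metric.tendsto_nhds.1 hfin (ε / 3) (by positivity)] with n hn
  have h1 := norm_nuclearPairing_le (h n).summable_left (h n).summable_right (hu n) (hv n) (K - K')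
  have h2 := norm_nuclearPairing_le h₀.summable_left h₀.summable_right hu₀ hv₀ (K - K')
  rw [map_sub] at h1 h2
  rw [dist_eq_norm] at hn ⊢
  set a := nuclearPairing (h n).summable_left (h n).summable_right K
  set a' := nuclearPairing (h n).summable_left (h n).summable_right K'
  set c := nuclearPairing h₀.summable_left h₀.summable_right K
  set c' := nuclearPairing h₀.summable_left h₀.summable_right K'
  calc ‖a - c‖ = ‖(a - a') + (a' - c') - (c - c')‖ := by congr 1; ring
    _ ≤ ‖a - a'‖ + ‖a' - c'‖ + ‖c - c'‖ := (norm_sub_le _ _).trans (by gcongr; exact norm_add_le _ _)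
    _ < ε := by linarith

end Nuclear

/-! ### Tensor products of square-integrable functions -/

section TensorProduct

open ContinuousLinearMap

/-- A square-integrable function whose integrals over all rectangles of finite measure vanish is
zero almost everywhere. -/
lemma ae_eq_zero_of_setIntegral_prod_eq_zero {α β : Type*} [MeasurableSpace α] [MeasurableSpace β]
    {μ : Measure α} {ν : Measure β} [SigmaFinite μ] [SigmaFinite ν] {ψ : α × β → ℂ}
    (hψ : MemLp ψ 2 (μ.prod ν))
    (h : ∀ A B, MeasurableSet A → MeasurableSet B → μ A < ⊤ → ν B < ⊤ →
      ∫ z in A ×ˢ B, ψ z ∂μ.prod ν = 0) : ψ =ᵐ[μ.prod ν] 0 := by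
  -- The product measure is exhausted by rectangles of finite measure, and on each of them the
  -- vanishing of the integrals passes from rectangles to all measurable sets.
  set S : ℕ → Set (α × β) := fun k => spanningSets μ k ×ˢ spanningSets ν k with hS
  have hSm : ∀ k, MeasurableSet (S k) := fun k =>
    (measurableSet_spanningSets μ k).prod (measurableSet_spanningSets ν k)
  have hSf : ∀ k, (μ.prod ν) (S k) < ⊤ := fun k => by
    rw [hS, Measure.prod_prod]
    exact ENNReal.mul_lt_top (measure_spanningSets_lt_top μ k) (measure_spanningSets_lt_top ν k)
  have hk : ∀ k, ∀ᵐ z ∂μ.prod ν, (S k).indicator ψ z = 0 := by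
    intro k
    have hi : Integrable ((S k).indicator ψ) (μ.prod ν) := by
      rw [integrable_indicator_iff (hSm k)]
      have : IsFiniteMeasure ((μ.prod ν).restrict (S k)) := ⟨by simpa using hSf k⟩
      exact (hψ.restrict _).integrable (by norm_num)
    have htot : ∫ z, (S k).indicator ψ z ∂μ.prod ν = 0 := by
      rw [integral_indicator (hSm k)]
      exact h _ _ (measurableSet_spanningSets μ k) (measurableSet_spanningSets ν k)
        (measure_spanningSets_lt_top μ k) (measure_spanningSets_lt_top ν k)
    have hall : ∀ t, MeasurableSet t → ∫ z in t, (S k).indicator ψ z ∂μ.prod ν = 0 := by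
      intro t ht
      induction t, ht using MeasurableSpace.induction_on_inter generateFrom_prod.symm
        isPiSystem_prod with
      | empty => simp
      | basic t ht =>
        obtain ⟨A, hA, B, hB, rfl⟩ := ht
        rw [setIntegral_indicator (hSm k), hS, Set.prod_inter_prod]
        exact h _ _ (MeasurableSet.inter hA (measurableSet_spanningSets μ k))
          (MeasurableSet.inter hB (measurableSet_spanningSets ν k))
          ((measure_mono Set.inter_subset_right).trans_lt (measure_spanningSets_lt_top μ k))
          ((measure_mono Set.inter_subset_right).trans_lt (measure_spanningSets_lt_top ν k))
      | compl t ht ih =>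
        have := integral_add_compl ht hi
        rwa [htot, ih, zero_add] at this
      | iUnion f hd hf ih =>
        rw [integral_iUnion hf hd hi.integrableOn]
        simp [ih]
    exact hi.ae_eq_zero_of_forall_setIntegral_eq_zero fun t ht _ => hall t ht
  filter_upwards [ae_all_iff.2 hk] with z hz
  obtain ⟨k₁, hk₁⟩ := Set.mem_iUnion.1 ((iUnion_spanningSets μ).symm ▸ Set.mem_univ z.1)
  obtain ⟨k₂, hk₂⟩ := Set.mem_iUnion.1 ((iUnion_spanningSets ν).symm ▸ Set.mem_univ z.2)
  have hm : z ∈ S (max k₁ k₂) := ⟨monotone_spanningSets μ (le_max_left _ _) hk₁,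
    monotone_spanningSets ν (le_max_right _ _) hk₂⟩
  simpa [Set.indicator_of_mem hm] using hz (max k₁ k₂)

variable {d n : ℕ}

lemma coeFn_tensor (f : OneBody d) (ψ : L2n d n) :
    tensor f ψ =ᵐ[volume] fun x => f (x 0) * ψ (fun i : Fin n => x i.succ) :=
  (memLp_tensor d n f ψ).coeFn_toLp

lemma tensor_ae_left {f g : EuclideanSpace ℝ (Fin d) → ℂ} (h : f =ᵐ[volume] g) :
    ∀ᵐ x : Fin (n + 1) → EuclideanSpace ℝ (Fin d), f (x 0) = g (x 0) :=
  ((Measure.quasiMeasurePreserving_fst (μ := volume) (ν := volume)).comp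
    (measurePreserving_cons d n).quasiMeasurePreserving).ae h

lemma tensor_add_left (f g : OneBody d) (ψ : L2n d n) :
    tensor (f + g) ψ = tensor f ψ + tensor g ψ := by
  apply Lp.ext
  filter_upwards [coeFn_tensor (f + g) ψ, coeFn_tensor f ψ, coeFn_tensor g ψ,
    Lp.coeFn_add (tensor f ψ) (tensor g ψ), tensor_ae_left (n := n) (Lp.coeFn_add f g)]
    with x h1 h2 h3 h4 h5
  rw [h4, Pi.add_apply, h1, h2, h3, h5, Pi.add_apply, add_mul]

lemma tensor_smul_left (c : ℂ) (f : OneBody d) (ψ : L2n d n) :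
    tensor (c • f) ψ = c • tensor f ψ := by
  apply Lp.ext
  filter_upwards [coeFn_tensor (c • f) ψ, coeFn_tensor f ψ,
    Lp.coeFn_smul c (tensor f ψ), tensor_ae_left (n := n) (Lp.coeFn_smul c f)]
    with x h1 h2 h4 h5
  rw [h4, Pi.smul_apply, h1, h2, h5, Pi.smul_apply, smul_eq_mul, smul_eq_mul, mul_assoc]

lemma integral_cons (F : EuclideanSpace ℝ (Fin d) × (Fin n → EuclideanSpace ℝ (Fin d)) → ℂ) :
    ∫ x : Fin (n + 1) → EuclideanSpace ℝ (Fin d), F (x 0, fun i => x i.succ) =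
      ∫ z, F z ∂(volume.prod volume) :=
  (volume_preserving_piFinSuccAbove (fun _ : Fin (n + 1) => EuclideanSpace ℝ (Fin d)) 0).integral_comp
    (MeasurableEquiv.measurableEmbedding _) F

lemma inner_tensor (f g : OneBody d) (φ ψ : L2n d n) :
    ⟪tensor f φ, tensor g ψ⟫_ℂ = ⟪f, g⟫_ℂ * ⟪φ, ψ⟫_ℂ := by
  simp only [L2.inner_def]
  rw [← integral_prod_mul (μ := volume) (ν := volume) (fun x => ⟪f x, g x⟫_ℂ) (fun y => ⟪φ y, ψ y⟫_ℂ),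
    ← integral_cons]
  refine integral_congr_ae ?_
  filter_upwards [coeFn_tensor f φ, coeFn_tensor g ψ] with x h1 h2
  rw [h1, h2]
  simp only [RCLike.inner_apply, map_mul]
  ring

/-- The tensor products of indicator functions detect the integrals over rectangles, so the tensor
products are total. -/
lemma eq_zero_of_inner_tensor_eq_zero {ψ : L2n d (n + 1)}
    (h : ∀ (f : OneBody d) (φ : L2n d n), ⟪tensor f φ, ψ⟫_ℂ = 0) : ψ = 0 := by
  set e := MeasurableEquiv.piFinSuccAbove (fun _ : Fin (n + 1) => EuclideanSpace ℝ (Fin d)) 0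
  have he : MeasurePreserving e :=
    volume_preserving_piFinSuccAbove (fun _ : Fin (n + 1) => EuclideanSpace ℝ (Fin d)) 0
  have h0 : (ψ ∘ e.symm) =ᵐ[(volume : Measure (EuclideanSpace ℝ (Fin d))).prod
      (volume : Measure (Fin n → EuclideanSpace ℝ (Fin d)))] 0 := by
    refine ae_eq_zero_of_setIntegral_prod_eq_zero ((Lp.memLp ψ).comp_measurePreserving he.symm) ?_
    intro A B hA hB hAf hBf
    have := h (indicatorConstLp 2 hA hAf.ne 1) (indicatorConstLp 2 hB hBf.ne 1)
    rw [L2.inner_def] at this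
    rw [← integral_indicator (hA.prod hB), ← this]
    rw [← integral_cons]
    refine integral_congr_ae ?_
    filter_upwards [coeFn_tensor (indicatorConstLp 2 hA hAf.ne 1) (indicatorConstLp 2 hB hBf.ne 1),
      tensor_ae_left (n := n) (indicatorConstLp_coeFn (p := 2) (hs := hA) (hμs := hAf.ne) (c := (1 : ℂ))),
      tensor_ae (indicatorConstLp_coeFn (p := 2) (hs := hB) (hμs := hBf.ne) (c := (1 : ℂ)))]
      with x h1 h2 h3
    rw [h1, h2, h3]
    have hx : e.symm (x 0, fun i => x i.succ) = x := e.symm_apply_apply x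
    by_cases ha : x 0 ∈ A <;> by_cases hb : (fun i : Fin n => x i.succ) ∈ B <;>
      simp [Set.indicator, ha, hb, hx]
  rw [Lp.eq_zero_iff_ae_eq_zero]
  have := he.quasiMeasurePreserving.ae h0
  filter_upwards [this] with x hx
  simpa using hx

lemma adjoint_tensorL_tensor (f g : OneBody d) (ψ : L2n d n) :
    adjoint (tensorL d n f) (tensor g ψ) = ⟪f, g⟫_ℂ • ψ := by
  refine ext_inner_left ℂ fun φ => ?_
  rw [adjoint_inner_right, inner_smul_right]
  exact inner_tensor f g φ ψ

lemma eq_zero_of_adjoint_tensorL {ψ : L2n d (n + 1)}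
    (h : ∀ f, adjoint (tensorL d n f) ψ = 0) : ψ = 0 := by
  refine eq_zero_of_inner_tensor_eq_zero fun f φ => ?_
  have := adjoint_inner_right (tensorL d n f) φ ψ
  rw [h, inner_zero_right] at this
  exact this.symm

lemma eq_of_adjoint_tensorL {ψ φ : L2n d (n + 1)}
    (h : ∀ f, adjoint (tensorL d n f) ψ = adjoint (tensorL d n f) φ) : ψ = φ :=
  sub_eq_zero.1 (eq_zero_of_adjoint_tensorL fun f => by rw [map_sub, h, sub_self])

lemma coeFn_permute (σ : Equiv.Perm (Fin n)) (ψ : L2n d n) :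
    permute σ ψ =ᵐ[volume] fun x => ψ (fun i => x (σ i)) :=
  Lp.coeFn_compMeasurePreserving ψ (measurePreserving_perm d n σ)

lemma permute_one (ψ : L2n d n) : permute 1 ψ = ψ :=
  Lp.compMeasurePreserving_id_apply ψ

lemma inner_permute_left (σ : Equiv.Perm (Fin n)) (φ ψ : L2n d n) :
    ⟪permute σ φ, ψ⟫_ℂ = ⟪φ, permute σ⁻¹ ψ⟫_ℂ := by
  rw [← (permute σ).inner_map_map φ, permute_mul, mul_inv_cancel, permute_one]

/-- The permutation of `n + 1` particles that fixes the first one and permutes the others by `e`. -/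
def extendPerm (e : Equiv.Perm (Fin n)) : Equiv.Perm (Fin (n + 1)) :=
  Equiv.Perm.decomposeFin.symm (0, e)

@[simp] lemma extendPerm_zero (e : Equiv.Perm (Fin n)) : extendPerm e 0 = 0 := by
  simp [extendPerm]

@[simp] lemma extendPerm_succ (e : Equiv.Perm (Fin n)) (i : Fin n) :
    extendPerm e i.succ = (e i).succ := by
  simp [extendPerm]

lemma decomposeFin_symm_eq (p : Fin (n + 1)) (e : Equiv.Perm (Fin n)) :
    Equiv.Perm.decomposeFin.symm (p, e) = Equiv.swap 0 p * extendPerm e := by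
  ext i
  refine Fin.cases ?_ (fun j => ?_) i <;> simp

lemma extendPerm_inv (e : Equiv.Perm (Fin n)) : (extendPerm e)⁻¹ = extendPerm e⁻¹ := by
  rw [inv_eq_iff_mul_eq_one]
  ext i
  refine Fin.cases ?_ (fun j => ?_) i <;> simp

lemma extendPerm_one : extendPerm (1 : Equiv.Perm (Fin n)) = 1 := by
  ext i
  refine Fin.cases ?_ (fun j => ?_) i <;> simp

lemma extendPerm_swap (a b : Fin n) :
    extendPerm (Equiv.swap a b) = Equiv.swap a.succ b.succ := by
  ext i
  refine Fin.cases ?_ (fun j => ?_) i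
  · rw [extendPerm_zero, Equiv.swap_apply_of_ne_of_ne] <;> simp [Fin.ext_iff]
  · rw [extendPerm_succ]
    simp only [Equiv.swap_apply_def, Fin.succ_inj]
    split_ifs <;> rfl

lemma permute_extendPerm_tensor (e : Equiv.Perm (Fin n)) (f : OneBody d) (ψ : L2n d n) :
    permute (extendPerm e) (tensor f ψ) = tensor f (permute e ψ) := by
  apply Lp.ext
  filter_upwards [coeFn_permute (extendPerm e) (tensor f ψ), coeFn_tensor f (permute e ψ),
    tensor_ae (coeFn_permute e ψ),
    (measurePreserving_perm d (n + 1) (extendPerm e)).quasiMeasurePreserving.ae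
      (coeFn_tensor f ψ)] with x h1 h2 h3 h4
  rw [h1, h2, h3, h4]
  simp

lemma permute_swap_tensor_tensor (f g : OneBody d) (ψ : L2n d n) :
    permute (Equiv.swap 0 1) (tensor f (tensor g ψ)) = tensor g (tensor f ψ) := by
  apply Lp.ext
  filter_upwards [coeFn_permute (Equiv.swap 0 1) (tensor f (tensor g ψ)),
    coeFn_tensor g (tensor f ψ), tensor_ae (coeFn_tensor f ψ),
    (measurePreserving_perm d (n + 2) (Equiv.swap 0 1)).quasiMeasurePreserving.ae
      (coeFn_tensor f (tensor g ψ)),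
    (measurePreserving_perm d (n + 2) (Equiv.swap 0 1)).quasiMeasurePreserving.ae
      (tensor_ae (coeFn_tensor g ψ))] with x h1 h2 h3 h4 h5
  rw [h1, h2, h3, h4, h5]
  have hs : ∀ i : Fin n, Equiv.swap (0 : Fin (n + 2)) 1 i.succ.succ = i.succ.succ := fun i =>
    Equiv.swap_apply_of_ne_of_ne (by simp [Fin.ext_iff]) (by simp [Fin.ext_iff])
  have h01 : (0 : Fin (n + 1)).succ = (1 : Fin (n + 2)) := rfl
  simp only [hs, h01, Equiv.swap_apply_left, Equiv.swap_apply_right]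
  ring

/-- To contract the second variable of `g ⊗ ψ` with `f` is to contract the first variable of
`ψ`. -/
lemma adjoint_tensorL_permute_swap (f g : OneBody d) (ψ : L2n d (n + 1)) :
    adjoint (tensorL d (n + 1) f) (permute (Equiv.swap 0 1) (tensor g ψ)) =
      tensor g (adjoint (tensorL d n f) ψ) := by
  refine eq_of_adjoint_tensorL fun h => ?_
  rw [adjoint_tensorL_tensor]
  refine ext_inner_left ℂ fun φ => ?_
  rw [adjoint_inner_right, adjoint_inner_right, inner_smul_right, adjoint_inner_right]
  change ⟪tensor f (tensor h φ), _⟫_ℂ = _ * ⟪tensor f φ, ψ⟫_ℂ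
  rw [← inner_tensor, ← permute_swap_tensor_tensor f h φ, inner_permute_left, Equiv.swap_inv]

lemma permute_adjoint_tensorL (e : Equiv.Perm (Fin n)) (f : OneBody d) (ψ : L2n d (n + 1)) :
    permute e (adjoint (tensorL d n f) ψ) =
      adjoint (tensorL d n f) (permute (extendPerm e) ψ) := by
  refine ext_inner_left ℂ fun φ => ?_
  rw [adjoint_inner_right, ← inv_inv e, ← inner_permute_left, adjoint_inner_right,
    ← extendPerm_inv, ← inner_permute_left]
  change ⟪tensor f _, _⟫_ℂ = ⟪permute _ (tensor f φ), _⟫_ℂ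
  rw [permute_extendPerm_tensor]

lemma continuous_tensor_left (ψ : L2n d n) : Continuous fun f : OneBody d => tensor f ψ := by
  let L : OneBody d →ₗ[ℂ] L2n d (n + 1) :=
    { toFun := fun f => tensor f ψ
      map_add' := fun f g => tensor_add_left f g ψ
      map_smul' := fun c f => tensor_smul_left c f ψ }
  exact (L.mkContinuous ‖ψ‖ fun f => by
    rw [mul_comm]; exact (norm_tensor f ψ).le).continuous

/-- For an orthonormal basis `e` of the one-body space, the operators `e i ⊗ ·` are isometries with
orthogonal ranges that span everything, so that Parseval's identity holds. -/
lemma hasSum_inner_adjoint_tensorL {ι : Type*} (e : HilbertBasis ι ℂ (OneBody d))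
    (φ ψ : L2n d (n + 1)) :
    HasSum (fun i => ⟪adjoint (tensorL d n (e i)) φ, adjoint (tensorL d n (e i)) ψ⟫_ℂ)
      ⟪φ, ψ⟫_ℂ := by
  let V : ι → (L2n d n →ₗᵢ[ℂ] L2n d (n + 1)) := fun i =>
    ⟨(tensorL d n (e i)).toLinearMap, fun ψ => (norm_tensor (e i) ψ).trans (by
      rw [e.orthonormal.1 i, one_mul])⟩
  refine hasSum_inner_adjoint V ?_ ?_ φ ψ
  · intro i j hij φ ψ
    refine (inner_tensor (e i) (e j) φ ψ).trans ?_
    rw [e.orthonormal.2 hij, zero_mul]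
  · intro x hx
    refine eq_zero_of_inner_tensor_eq_zero fun f φ => ?_
    have hfe : HasSum (fun i => ⟪tensor (e.repr f i • e i) φ, x⟫_ℂ) ⟪tensor f φ, x⟫_ℂ := by
      let L : OneBody d →+ ℂ :=
        { toFun := fun g => ⟪tensor g φ, x⟫_ℂ
          map_zero' := by
            have := tensor_smul_left 0 (0 : OneBody d) φ
            rw [zero_smul, zero_smul] at this
            rw [this, inner_zero_left]
          map_add' := fun g h => by rw [tensor_add_left, inner_add_left] }
      exact (e.hasSum_repr f).map L ((continuous_tensor_left φ).inner continuous_const)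
    refine hfe.unique ?_
    convert hasSum_zero with i
    rw [tensor_smul_left, inner_smul_left]
    have := adjoint_inner_right (tensorL d n (e i)) φ x
    rw [show adjoint (tensorL d n (e i)) x = 0 from hx i, inner_zero_right] at this
    rw [show ⟪tensor (e i) φ, x⟫_ℂ = 0 from this.symm, mul_zero]

end TensorProduct

/-! ### The canonical (anti)commutation relations -/

section Relations

open ContinuousLinearMap

/-- The sign `ζ` of the exchange of two particles: `1` for bosons, `-1` for fermions. -/
def Statistics.exchange : Statistics → ℂ
  | .boson => 1
  | .fermion => -1

lemma Statistics.exchange_mul_self (s : Statistics) : s.exchange * s.exchange = 1 := by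
  cases s <;> simp [Statistics.exchange]

lemma Statistics.conj_exchange (s : Statistics) : (starRingEnd ℂ) s.exchange = s.exchange := by
  cases s <;> simp [Statistics.exchange]

variable {s : Statistics} {d n : ℕ}

lemma nBody_inner_smul_left (c : ℂ) (φ ψ : nBody s d n) :
    ⟪c • φ, ψ⟫_ℂ = (starRingEnd ℂ) c * ⟪φ, ψ⟫_ℂ :=
  inner_smul_left (E := nBody s d n) _ _ _

lemma nBody_inner_smul_right (c : ℂ) (φ ψ : nBody s d n) :
    ⟪φ, c • ψ⟫_ℂ = c * ⟪φ, ψ⟫_ℂ :=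
  inner_smul_right (E := nBody s d n) _ _ _

lemma char_mul_self (σ : Equiv.Perm (Fin n)) :
    ((s.char σ : ℤ) : ℂ) * ((s.char σ : ℤ) : ℂ) = 1 := by
  rw [← Int.cast_mul, ← Units.val_mul, Int.units_mul_self]
  simp

lemma char_swap {i j : Fin n} (h : i ≠ j) : ((s.char (Equiv.swap i j) : ℤ) : ℂ) = s.exchange := by
  cases s <;> simp [Statistics.char, Statistics.exchange, Equiv.Perm.sign_swap h]

lemma char_extendPerm (e : Equiv.Perm (Fin n)) : s.char (extendPerm e) = s.char e := by
  cases s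
  · rfl
  · simp [Statistics.char, extendPerm, Equiv.Perm.decomposeFin.symm_sign]

lemma char_inv (σ : Equiv.Perm (Fin n)) : s.char σ⁻¹ = s.char σ := by
  rw [map_inv, Int.units_inv_eq_self]

lemma permute_mem_nBody (σ : Equiv.Perm (Fin n)) (ψ : nBody s d n) :
    permute σ (ψ : L2n d n) = ((s.char σ : ℤ) : ℂ) • (ψ : L2n d n) := ψ.2 σ

lemma symSum_apply (Φ : L2n d n) :
    symSum s d n Φ = ∑ σ : Equiv.Perm (Fin n), ((s.char σ : ℤ) : ℂ) • permute σ Φ := by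
  simp [symSum, sum_apply]

lemma symSum_coe (ψ : nBody s d n) : symSum s d n ψ = (n.factorial : ℂ) • (ψ : L2n d n) := by
  rw [symSum_apply]
  simp only [permute_mem_nBody, smul_smul, char_mul_self, one_smul]
  simp [Fintype.card_perm, Nat.cast_smul_eq_nsmul]

lemma inner_symSum_left (φ ψ : L2n d n) : ⟪symSum s d n φ, ψ⟫_ℂ = ⟪φ, symSum s d n ψ⟫_ℂ := by
  rw [symSum_apply, symSum_apply, sum_inner, inner_sum]
  refine Fintype.sum_equiv (Equiv.inv _) _ _ fun σ => ?_
  rw [inner_smul_left, inner_smul_right, inner_permute_left, Equiv.inv_apply, char_inv]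
  simp

lemma adjoint_tensorL_mem (f : OneBody d) (ψ : nBody s d (n + 1)) :
    adjoint (tensorL d n f) (ψ : L2n d (n + 1)) ∈ nBody s d n := by
  intro e
  rw [permute_adjoint_tensorL, permute_mem_nBody, map_smul, char_extendPerm]

lemma sqrt_factorial_inv (n : ℕ) :
    (Real.sqrt (n.factorial * (n + 1).factorial))⁻¹ * (n + 1).factorial = Real.sqrt (n + 1) := by
  have h1 : (0 : ℝ) < n.factorial := by exact_mod_cast n.factorial_pos
  have h2 : (((n + 1).factorial : ℕ) : ℝ) = (n + 1) * n.factorial := by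
    rw [Nat.factorial_succ]; push_cast; ring
  rw [h2, show (n.factorial : ℝ) * ((n + 1) * n.factorial) = (n + 1) * (n.factorial * n.factorial)
    by ring, Real.sqrt_mul (by positivity), Real.sqrt_mul_self h1.le]
  have h3 : Real.sqrt ((n : ℝ) + 1) ≠ 0 := by positivity
  field_simp
  rw [Real.sq_sqrt (by positivity)]

/-- Annihilation integrates out one variable against `f`: it is `√(n+1)` times the adjoint of the
tensor product with `f`. -/
lemma coe_annihilate (f : OneBody d) (ψ : nBody s d (n + 1)) :
    (annihilate s d n f ψ : L2n d n) =
      ((Real.sqrt (n + 1) : ℝ) : ℂ) • adjoint (tensorL d n f) (ψ : L2n d (n + 1)) := by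
  have h : annihilate s d n f ψ =
      ((Real.sqrt (n + 1) : ℝ) : ℂ) • (⟨_, adjoint_tensorL_mem f ψ⟩ : nBody s d n) := by
    refine ext_inner_left ℂ fun φ => ?_
    rw [annihilate, adjoint_inner_right, nBody_inner_smul_right, Submodule.coe_inner, Submodule.coe_inner,
      adjoint_inner_right]
    change ⟪(((Real.sqrt (n.factorial * (n + 1).factorial))⁻¹ : ℝ) : ℂ) •
      symSum s d (n + 1) (tensor f (φ : L2n d n)), _⟫_ℂ = _ * ⟪tensor f (φ : L2n d n), _⟫_ℂ
    rw [inner_smul_left, inner_symSum_left, symSum_coe, inner_smul_right, ← mul_assoc,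
      ← sqrt_factorial_inv n]
    simp
  rw [h]
  rfl

/-- Creation is a sum over the position `p` of the new particle: the permutations are written as
`(0 p)` times a permutation of the other particles, under which the wavefunction has its
symmetry. -/
lemma coe_create (f : OneBody d) (ψ : nBody s d n) :
    (create s d n f ψ : L2n d (n + 1)) = (((Real.sqrt (n + 1))⁻¹ : ℝ) : ℂ) •
      ∑ p : Fin (n + 1), ((s.char (Equiv.swap 0 p) : ℤ) : ℂ) •
        permute (Equiv.swap 0 p) (tensor f (ψ : L2n d n)) := by
  have h : symSum s d (n + 1) (tensor f (ψ : L2n d n)) = (n.factorial : ℂ) •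
      ∑ p : Fin (n + 1), ((s.char (Equiv.swap 0 p) : ℤ) : ℂ) •
        permute (Equiv.swap 0 p) (tensor f (ψ : L2n d n)) := by
    rw [symSum_apply, ← Equiv.sum_comp Equiv.Perm.decomposeFin.symm, Fintype.sum_prod_type,
      Finset.smul_sum]
    refine Finset.sum_congr rfl fun p _ => ?_
    have : ∀ e : Equiv.Perm (Fin n), ((s.char (Equiv.Perm.decomposeFin.symm (p, e)) : ℤ) : ℂ) •
        permute (Equiv.Perm.decomposeFin.symm (p, e)) (tensor f (ψ : L2n d n)) =
        ((s.char (Equiv.swap 0 p) : ℤ) : ℂ) •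
          permute (Equiv.swap 0 p) (tensor f (ψ : L2n d n)) := fun e => by
      have ht : tensor f (((s.char e : ℤ) : ℂ) • (ψ : L2n d n)) =
        ((s.char e : ℤ) : ℂ) • tensor f (ψ : L2n d n) := (tensorL d n f).map_smul _ _
      rw [decomposeFin_symm_eq, ← permute_mul, permute_extendPerm_tensor, permute_mem_nBody, ht,
        map_smul, smul_smul, map_mul, char_extendPerm]
      push_cast
      rw [mul_assoc, char_mul_self, mul_one]
    rw [Fintype.sum_congr _ _ this]
    simp [Fintype.card_perm, Nat.cast_smul_eq_nsmul]
  change (((Real.sqrt (n.factorial * (n + 1).factorial))⁻¹ : ℝ) : ℂ) •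
      symSum s d (n + 1) (tensor f (ψ : L2n d n)) = _
  rw [h, smul_smul]
  congr 1
  have h1 : (n.factorial : ℝ) ≠ 0 := by exact_mod_cast n.factorial_ne_zero
  have h3 : Real.sqrt ((n : ℝ) + 1) ≠ 0 := by positivity
  have h2 := sqrt_factorial_inv n
  rw [Nat.factorial_succ] at h2 ⊢
  have h4 : (Real.sqrt (n.factorial * ((n + 1) * n.factorial : ℕ)))⁻¹ * n.factorial =
      (Real.sqrt (n + 1))⁻¹ := by
    have h5 : Real.sqrt ((n : ℝ) + 1) * Real.sqrt (n + 1) = n + 1 :=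
      Real.mul_self_sqrt (by positivity)
    refine eq_inv_of_mul_eq_one_left (mul_right_cancel₀ h3 ?_)
    rw [mul_assoc, h5, one_mul, ← h2]
    push_cast
    ring
  exact_mod_cast congrArg (Complex.ofReal) h4

/-- The canonical (anti)commutation relation between annihilation and creation operators. -/
lemma annihilate_create (f g : OneBody d) (ψ : nBody s d (n + 1)) :
    annihilate s d (n + 1) f (create s d (n + 1) g ψ) =
      ⟪f, g⟫_ℂ • ψ + s.exchange • create s d n g (annihilate s d n f ψ) := by
  apply Subtype.ext
  have hsq : ∀ m : ℕ, ((Real.sqrt (m + 1) : ℝ) : ℂ) ≠ 0 := fun m => by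
    norm_cast; positivity
  have ht : ∀ (c : ℂ) (φ : L2n d n), tensor g (c • φ) = c • tensor g φ :=
    (tensorL d n g).map_smul
  have hsw : ∀ j : Fin (n + 1), adjoint (tensorL d (n + 1) f)
      (permute (Equiv.swap 0 j.succ) (tensor g (ψ : L2n d (n + 1)))) =
      ((s.char (Equiv.swap 0 j) : ℤ) : ℂ) • permute (Equiv.swap 0 j)
        (tensor g (adjoint (tensorL d n f) (ψ : L2n d (n + 1)))) := by
    intro j
    -- `(0 j+1)` is the conjugate of `(0 1)` by the transposition `(1 j+1)`, which fixes `0`.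
    have hdec : Equiv.swap (0 : Fin (n + 2)) j.succ =
        extendPerm (Equiv.swap 0 j) * Equiv.swap 0 1 * extendPerm (Equiv.swap 0 j) := by
      rcases Fin.eq_zero_or_eq_succ j with rfl | ⟨k, rfl⟩
      · simp [← Equiv.Perm.one_def, extendPerm_one]
      · rw [extendPerm_swap]
        have h := Equiv.swap_mul_swap_mul_swap (x := (0 : Fin (n + 2))) (y := 1)
          (z := k.succ.succ) (by simp) (by simp [Fin.ext_iff])
        rw [Equiv.swap_comm, ← h]
        rfl
    rw [hdec, ← permute_mul, ← permute_mul, permute_extendPerm_tensor, permute_mem_nBody,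
      ← permute_adjoint_tensorL, adjoint_tensorL_permute_swap, map_smul]
    rw [ht, map_smul]
  rw [coe_annihilate, coe_create, map_smul, map_sum, Fin.sum_univ_succ]
  simp only [map_smul, hsw, char_swap (Fin.succ_ne_zero _).symm]
  rw [Submodule.coe_add, Submodule.coe_smul, Submodule.coe_smul, coe_create, coe_annihilate]
  simp only [ht, map_smul, Finset.smul_sum, smul_smul, smul_add]
  congr 1
  · have h1 : Equiv.swap (0 : Fin (n + 1 + 1)) 0 = 1 := Equiv.swap_self 0
    rw [h1, permute_one, adjoint_tensorL_tensor, map_one]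
    have := hsq (n + 1)
    rw [Complex.ofReal_inv, ← mul_assoc, mul_inv_cancel₀ this]
    simp
  · refine Finset.sum_congr rfl fun x _ => ?_
    congr 1
    have h1 := hsq (n + 1)
    have h2 := hsq n
    rw [Complex.ofReal_inv, Complex.ofReal_inv]
    field_simp

lemma annihilate_create_zero (f g : OneBody d) (ψ : nBody s d 0) :
    annihilate s d 0 f (create s d 0 g ψ) = ⟪f, g⟫_ℂ • ψ := by
  apply Subtype.ext
  rw [coe_annihilate, coe_create]
  simp [← Equiv.Perm.one_def, permute_one, adjoint_tensorL_tensor]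

/-- Annihilation operators (anti)commute. -/
lemma annihilate_annihilate (f g : OneBody d) (ψ : nBody s d (n + 2)) :
    annihilate s d n f (annihilate s d (n + 1) g ψ) =
      s.exchange • annihilate s d n g (annihilate s d (n + 1) f ψ) := by
  apply Subtype.ext
  rw [Submodule.coe_smul]
  simp only [coe_annihilate, map_smul]
  rw [smul_comm s.exchange, smul_comm s.exchange]
  congr 2
  refine ext_inner_left ℂ fun φ => ?_
  rw [inner_smul_right]
  simp only [adjoint_inner_right]
  change ⟪tensor g (tensor f φ), _⟫_ℂ = _ * ⟪tensor f (tensor g φ), _⟫_ℂ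
  rw [← permute_swap_tensor_tensor f g φ, inner_permute_left, Equiv.swap_inv, permute_mem_nBody,
    char_swap (by simp), inner_smul_right]

/-- The number operator on `n + 1` particles is `n + 1`. -/
lemma hasSum_inner_annihilate {ι : Type*} (e : HilbertBasis ι ℂ (OneBody d))
    (φ ψ : nBody s d (n + 1)) :
    HasSum (fun i => ⟪annihilate s d n (e i) φ, annihilate s d n (e i) ψ⟫_ℂ)
      ((n + 1) * ⟪φ, ψ⟫_ℂ) := by
  have := (hasSum_inner_adjoint_tensorL e (φ : L2n d (n + 1)) ψ).mul_left ((n : ℂ) + 1)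
  rw [Submodule.coe_inner]
  refine this.congr_fun fun i => ?_
  rw [Submodule.coe_inner, coe_annihilate, coe_annihilate, inner_smul_left, inner_smul_right,
    ← mul_assoc, Complex.conj_ofReal, ← Complex.ofReal_mul, Real.mul_self_sqrt (by positivity)]
  simp

lemma eq_zero_of_annihilate_eq_zero {ψ : nBody s d (n + 1)}
    (h : ∀ f, annihilate s d n f ψ = 0) : ψ = 0 := by
  apply Subtype.ext
  refine eq_zero_of_adjoint_tensorL fun f => ?_
  have := congrArg Subtype.val (h f)
  rw [coe_annihilate] at this
  exact (smul_eq_zero.1 this).resolve_left (by norm_cast; positivity)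

/-- The configuration space of no particles is a single point, so that the vacuum spans the
zero-body space. -/
lemma exists_smul_vacuum (ψ : nBody s d 0) : ∃ c : ℂ, ψ = c • vacuum s d := by
  refine ⟨(ψ : L2n d 0) default, Subtype.ext (Lp.ext ?_)⟩
  rw [Submodule.coe_smul]
  filter_upwards [Lp.coeFn_smul ((ψ : L2n d 0) default) (vacuum s d : L2n d 0),
    indicatorConstLp_coeFn (p := 2) (μ := (volume : Measure (Fin 0 → EuclideanSpace ℝ (Fin d))))
      (hs := MeasurableSet.univ) (hμs := by simp [volume_pi]) (c := (1 : ℂ))] with x h1 h2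
  have h3 : (vacuum s d : L2n d 0) x = 1 := h2.trans (by simp)
  rw [h1, Pi.smul_apply, h3, smul_eq_mul, mul_one, Subsingleton.elim x default]

lemma inner_vacuum_vacuum : ⟪vacuum s d, vacuum s d⟫_ℂ = 1 := by
  refine (inner_self_eq_norm_sq_to_K (𝕜 := ℂ) (vacuum s d)).trans ?_
  have : ‖vacuum s d‖ = 1 := by
    rw [Submodule.coe_norm]
    refine (norm_indicatorConstLp (hs := MeasurableSet.univ) (hμs := by simp [volume_pi])
      (by simp) (by simp)).trans ?_
    simp [volume_pi, Measure.real]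
  simp [this]

end Relations

/-! ### Strings of annihilation operators -/

section Strings

open ContinuousLinearMap

variable {s : Statistics} {d : ℕ}

lemma aOp_apply (f : OneBody d) (Φ : FockSeq s d) (n : ℕ) :
    aOp f Φ n = annihilate s d n f (Φ (n + 1)) := rfl

lemma aDag_zero (f : OneBody d) (Φ : FockSeq s d) : aDag f Φ 0 = 0 := rfl

lemma aDag_succ (f : OneBody d) (Φ : FockSeq s d) (n : ℕ) :
    aDag f Φ (n + 1) = create s d n f (Φ n) := rfl

lemma annihilationString_succ (p : ℕ) (g : Fin (p + 1) → OneBody d) (Φ : FockSeq s d) :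
    annihilationString (p + 1) g Φ = annihilationString p (fun i => g i.succ) (aOp (g 0) Φ) := rfl

lemma creationString_succ (p : ℕ) (g : Fin (p + 1) → OneBody d) (Φ : FockSeq s d) :
    creationString (p + 1) g Φ = aDag (g 0) (creationString p (fun i => g i.succ) Φ) := rfl

lemma prodVec_succ (p : ℕ) (g : Fin (p + 1) → OneBody d) :
    prodVec s d (p + 1) g = create s d p (g 0) (prodVec s d p fun i => g i.succ) := rfl

lemma inner_create_left {n : ℕ} (f : OneBody d) (φ : nBody s d n) (ψ : nBody s d (n + 1)) :
    ⟪create s d n f φ, ψ⟫_ℂ = ⟪φ, annihilate s d n f ψ⟫_ℂ :=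
  (adjoint_inner_right _ _ _).symm

/-- Creating particles from the vacuum is adjoint to annihilating down to the vacuum. -/
lemma inner_prodVec (p : ℕ) (g : Fin p → OneBody d) (Φ : FockSeq s d) :
    ⟪prodVec s d p g, Φ p⟫_ℂ = ⟪vacuum s d, annihilationString p g Φ 0⟫_ℂ := by
  induction p generalizing Φ with
  | zero => rfl
  | succ p ih => rw [prodVec_succ, inner_create_left, annihilationString_succ, ← ih, aOp_apply]

/-- The product vectors are total. -/
lemma eq_zero_of_inner_prodVec_eq_zero {p : ℕ} {ψ : nBody s d p}
    (h : ∀ g, ⟪prodVec s d p g, ψ⟫_ℂ = 0) : ψ = 0 := by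
  induction p with
  | zero =>
    obtain ⟨c, rfl⟩ := exists_smul_vacuum ψ
    have := h Fin.elim0
    rw [nBody_inner_smul_right] at this
    rw [show prodVec s d 0 Fin.elim0 = vacuum s d from rfl, inner_vacuum_vacuum, mul_one] at this
    rw [this, zero_smul]
  | succ p ih =>
    refine eq_zero_of_annihilate_eq_zero fun f => ih fun g => ?_
    have := h (Fin.cons f g)
    rw [prodVec_succ, inner_create_left] at this
    simpa using this

/-- The linear extension of `f₁ ∘ ⋯ ∘ f_p` to formal linear combinations of strings. -/
def prodVecLin (s : Statistics) (d p : ℕ) : ((Fin p → OneBody d) →₀ ℂ) →ₗ[ℂ] nBody s d p :=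
  Finsupp.linearCombination ℂ (prodVec s d p)

lemma prodVecLin_single (p : ℕ) (f : Fin p → OneBody d) :
    prodVecLin s d p (Finsupp.single f 1) = prodVec s d p f := by
  simp [prodVecLin]

lemma denseRange_prodVecLin (p : ℕ) : DenseRange (prodVecLin s d p) := by
  have h : (LinearMap.range (prodVecLin s d p)).topologicalClosure = ⊤ := by
    rw [Submodule.topologicalClosure_eq_top_iff, Submodule.eq_bot_iff]
    intro ψ hψ
    refine eq_zero_of_inner_prodVec_eq_zero fun g => ?_
    refine (Submodule.mem_orthogonal _ _).1 hψ _ ⟨Finsupp.single g 1, prodVecLin_single p g⟩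
  intro ψ
  have : ψ ∈ (LinearMap.range (prodVecLin s d p)).topologicalClosure := h ▸ Submodule.mem_top
  exact this

/-- Bounded operators are determined by their matrix elements between product vectors. -/
lemma ext_of_inner_prodVec {p q : ℕ} {D D' : nBody s d q →L[ℂ] nBody s d p}
    (h : ∀ f g, ⟪prodVec s d p g, D (prodVec s d q f)⟫_ℂ =
      ⟪prodVec s d p g, D' (prodVec s d q f)⟫_ℂ) : D = D' := by
  have h1 : ∀ f, D (prodVec s d q f) = D' (prodVec s d q f) := fun f =>
    sub_eq_zero.1 (eq_zero_of_inner_prodVec_eq_zero fun g => by rw [inner_sub_right, h, sub_self])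
  ext1 ψ
  refine (denseRange_prodVecLin q).induction_on (p := fun ψ => D ψ = D' ψ) ψ
    (isClosed_eq D.continuous D'.continuous) fun c => ?_
  simp [prodVecLin, Finsupp.linearCombination_apply, Finsupp.sum, h1]

lemma aOp_aOp (f g : OneBody d) (Φ : FockSeq s d) :
    aOp f (aOp g Φ) = s.exchange • aOp g (aOp f Φ) := by
  funext n
  exact annihilate_annihilate f g (Φ (n + 2))

lemma annihilationString_aOp (p : ℕ) (g : Fin p → OneBody d) (f : OneBody d) (Φ : FockSeq s d) :
    annihilationString p g (aOp f Φ) = s.exchange ^ p • aOp f (annihilationString p g Φ) := by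
  induction p generalizing Φ with
  | zero => simp [annihilationString]
  | succ p ih =>
    rw [annihilationString_succ, aOp_aOp, map_smul, ih, annihilationString_succ, smul_smul, pow_succ']

/-- Strings of annihilation operators (anti)commute. -/
lemma annihilationString_comm (n p : ℕ) (k : Fin n → OneBody d) (g : Fin p → OneBody d)
    (Φ : FockSeq s d) :
    annihilationString n k (annihilationString p g Φ) =
      s.exchange ^ (p * n) • annihilationString p g (annihilationString n k Φ) := by
  induction n generalizing Φ with
  | zero => simp [annihilationString]
  | succ n ih =>
    rw [annihilationString_succ, annihilationString_succ]
    have h := annihilationString_aOp p g (k 0) Φ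
    have h' : aOp (k 0) (annihilationString p g Φ) =
        s.exchange ^ p • annihilationString p g (aOp (k 0) Φ) := by
      rw [h, smul_smul, ← mul_pow, s.exchange_mul_self, one_pow, one_smul]
    rw [h', map_smul, ih, smul_smul, ← pow_add, mul_add, mul_one, add_comm]

lemma inner_self_eq_ofReal {E : Type*} [NormedAddCommGroup E] [InnerProductSpace ℂ E] (x : E) :
    ⟪x, x⟫_ℂ = ((‖x‖ ^ 2 : ℝ) : ℂ) := by
  rw [Complex.ofReal_pow]
  exact inner_self_eq_norm_sq_to_K (𝕜 := ℂ) x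

lemma hasSum_prod_of_nonneg {α β : Type*} {f : α × β → ℝ} {g : α → ℝ} {a : ℝ} (hf : ∀ z, 0 ≤ f z)
    (hg : ∀ x, HasSum (fun y => f (x, y)) (g x)) (ha : HasSum g a) : HasSum f a := by
  have hs : Summable f := by
    rw [summable_prod_of_nonneg hf]
    refine ⟨fun x => (hg x).summable, ?_⟩
    simpa only [(hg _).tsum_eq] using ha.summable
  rw [← (hs.hasSum.prod_fiberwise hg).unique ha]
  exact hs.hasSum

/-- Annihilating `n` particles in all possible basis states: the sum of the squares is the
expectation of `(p+1) ⋯ (p+n)`. -/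
lemma hasSum_norm_sq_annihilationString {ι : Type*} (e : HilbertBasis ι ℂ (OneBody d)) (n p m : ℕ)
    (hm : m = p + n) (Φ : FockSeq s d) :
    HasSum (fun K : Fin n → ι => ‖annihilationString n (fun i => e (K i)) Φ p‖ ^ 2)
      ((m.factorial / p.factorial : ℝ) * ‖Φ m‖ ^ 2) := by
  induction n generalizing Φ m with
  | zero =>
    obtain rfl : m = p := hm
    have h : (m.factorial : ℝ) ≠ 0 := by exact_mod_cast m.factorial_ne_zero
    rw [div_self h, one_mul]
    exact hasSum_unique (fun K : Fin 0 → ι => ‖annihilationString 0 (fun i => e (K i)) Φ m‖ ^ 2)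
  | succ n ih =>
    subst hm
    rw [← (Fin.consEquiv fun _ => ι).hasSum_iff]
    refine hasSum_prod_of_nonneg (fun _ => by simp only [Function.comp_apply]; positivity)
      (g := fun i => ((p + n).factorial / p.factorial : ℝ) * ‖aOp (e i) Φ (p + n)‖ ^ 2)
      (fun i => ih (p + n) rfl (aOp (e i) Φ)) ?_
    have h := (hasSum_inner_annihilate e (Φ (p + n + 1)) (Φ (p + n + 1))).mapL Complex.reCLM
    have h2 := h.mul_left ((p + n).factorial / p.factorial : ℝ)
    have hval : ((p + (n + 1)).factorial / p.factorial : ℝ) * ‖Φ (p + (n + 1))‖ ^ 2 =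
        ((p + n).factorial / p.factorial : ℝ) *
          Complex.reCLM (((p + n : ℕ) + 1) * ⟪Φ (p + n + 1), Φ (p + n + 1)⟫_ℂ) := by
      have h4 : (((p + n : ℕ) : ℂ) + 1) * ((‖Φ (p + n + 1)‖ ^ 2 : ℝ) : ℂ) =
        (((((p + n : ℕ) : ℝ) + 1) * ‖Φ (p + n + 1)‖ ^ 2 : ℝ) : ℂ) := by push_cast; ring
      rw [inner_self_eq_ofReal, h4, Complex.reCLM_apply, Complex.ofReal_re, ← add_assoc,
        Nat.factorial_succ]
      push_cast
      ring
    rw [hval]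
    refine h2.congr_fun fun i => ?_
    rw [inner_self_eq_ofReal, Complex.reCLM_apply, Complex.ofReal_re, aOp_apply]

/-- The product vectors of the elements of a one-body basis, with weight `1/n!`, resolve the
identity of the `n`-body space. -/
lemma hasSum_inner_prodVec_mul {ι : Type*} (e : HilbertBasis ι ℂ (OneBody d)) (n : ℕ)
    (φ ψ : nBody s d n) :
    HasSum (fun K : Fin n → ι => ⟪φ, prodVec s d n (fun i => e (K i))⟫_ℂ *
      ⟪prodVec s d n (fun i => e (K i)), ψ⟫_ℂ) (n.factorial * ⟪φ, ψ⟫_ℂ) := by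
  have hnorm : ∀ χ : nBody s d n, HasSum
      (fun K : Fin n → ι => ‖⟪prodVec s d n (fun i => e (K i)), χ⟫_ℂ‖ ^ 2)
      (n.factorial * ‖χ‖ ^ 2) := by
    intro χ
    have h := hasSum_norm_sq_annihilationString e n 0 n (by simp) (Function.update 0 n χ)
    simp only [Function.update_self, Nat.factorial_zero, Nat.cast_one, div_one] at h
    refine h.congr_fun fun K => ?_
    have h1 := inner_prodVec n (fun i => e (K i)) (Function.update (0 : FockSeq s d) n χ)
    rw [Function.update_self] at h1
    rw [h1]
    obtain ⟨c, hc⟩ := exists_smul_vacuum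
      (annihilationString n (fun i => e (K i)) (Function.update (0 : FockSeq s d) n χ) 0)
    have hv : ‖vacuum s d‖ = 1 := by
      have : ‖vacuum s d‖ ^ 2 = 1 := by
        have := inner_self_eq_ofReal (vacuum s d)
        rw [inner_vacuum_vacuum] at this
        exact_mod_cast this.symm
      nlinarith [norm_nonneg (vacuum s d)]
    rw [hc, nBody_inner_smul_right, inner_vacuum_vacuum, norm_smul, hv, mul_one, mul_one]
  -- The case `φ = ψ` gives the general one, by polarization on both sides.
  have key : ∀ x y : ℂ, (starRingEnd ℂ) x * y = (((‖x + y‖ ^ 2 : ℝ) : ℂ) - ((‖x - y‖ ^ 2 : ℝ) : ℂ)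
      + ((‖x - Complex.I * y‖ ^ 2 : ℝ) - (‖x + Complex.I * y‖ ^ 2 : ℝ)) * Complex.I) / 4 := by
    intro x y
    have := inner_eq_sum_norm_sq_div_four (𝕜 := ℂ) x y
    simp only [RCLike.inner_apply', smul_eq_mul] at this
    rw [this]
    push_cast
    rfl
  have h1 := (Complex.hasSum_ofReal.2 (hnorm (φ + ψ))).sub (Complex.hasSum_ofReal.2 (hnorm (φ - ψ)))
  have h2 := ((Complex.hasSum_ofReal.2 (hnorm (φ - Complex.I • ψ))).sub
    (Complex.hasSum_ofReal.2 (hnorm (φ + Complex.I • ψ)))).mul_right Complex.I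
  have h3 := (h1.add h2).div_const 4
  have hp : ⟪φ, ψ⟫_ℂ = (((‖φ + ψ‖ ^ 2 : ℝ) : ℂ) - ((‖φ - ψ‖ ^ 2 : ℝ) : ℂ) +
      ((‖φ - Complex.I • ψ‖ ^ 2 : ℝ) - (‖φ + Complex.I • ψ‖ ^ 2 : ℝ)) * Complex.I) / 4 := by
    have := inner_eq_sum_norm_sq_div_four (𝕜 := ℂ) φ ψ
    push_cast
    exact this
  have hval : n.factorial * ⟪φ, ψ⟫_ℂ =
      (((n.factorial * ‖φ + ψ‖ ^ 2 : ℝ) : ℂ) - ((n.factorial * ‖φ - ψ‖ ^ 2 : ℝ) : ℂ) +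
        ((n.factorial * ‖φ - Complex.I • ψ‖ ^ 2 : ℝ) -
          (n.factorial * ‖φ + Complex.I • ψ‖ ^ 2 : ℝ)) * Complex.I) / 4 := by
    rw [hp]
    push_cast
    ring
  rw [hval]
  refine h3.congr_fun fun K => ?_
  rw [← inner_conj_symm φ, key]
  simp only [inner_add_right, inner_sub_right, nBody_inner_smul_right]

end Strings

/-! ### Annihilation operators on the truncated Fock space -/

section Truncated

open ContinuousLinearMap

variable {s : Statistics} {d N : ℕ}

lemma incl_apply_of_le (Φ : TruncFock s d N) {n : ℕ} (h : n ≤ N) :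
    TruncFock.incl Φ n = Φ ⟨n, Nat.lt_succ_of_le h⟩ := dif_pos h

lemma incl_apply_of_lt (Φ : TruncFock s d N) {n : ℕ} (h : N < n) : TruncFock.incl Φ n = 0 :=
  dif_neg (not_le.2 h)

lemma incl_apply_fin (Φ : TruncFock s d N) (n : Fin (N + 1)) : TruncFock.incl Φ n = Φ n :=
  incl_apply_of_le Φ (Nat.le_of_lt_succ n.2)

lemma proj_apply (Φ : FockSeq s d) (n : Fin (N + 1)) :
    (TruncFock.proj Φ : TruncFock s d N) n = Φ n := rfl

lemma proj_incl (Φ : TruncFock s d N) : TruncFock.proj (TruncFock.incl Φ) = Φ := by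
  ext1 n
  rw [proj_apply, incl_apply_fin]

lemma norm_incl_apply_le (Φ : TruncFock s d N) (n : ℕ) : ‖TruncFock.incl Φ n‖ ≤ ‖Φ‖ := by
  rcases le_or_gt n N with h | h
  · rw [incl_apply_of_le Φ h]
    exact PiLp.norm_apply_le Φ _
  · rw [incl_apply_of_lt Φ h, norm_zero]
    exact norm_nonneg _

lemma continuous_incl : Continuous (TruncFock.incl : TruncFock s d N →ₗ[ℂ] FockSeq s d) := by
  refine continuous_pi fun n => ?_
  rcases le_or_gt n N with h | h
  · simp only [incl_apply_of_le _ h]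
    fun_prop
  · simp only [incl_apply_of_lt _ h]
    fun_prop

lemma continuous_proj : Continuous (TruncFock.proj : FockSeq s d →ₗ[ℂ] TruncFock s d N) := by
  refine (PiLp.continuous_toLp 2 _).comp (continuous_pi fun n => ?_)
  exact continuous_apply (n : ℕ)

lemma continuous_aOp (f : OneBody d) : Continuous (aOp (s := s) f) :=
  continuous_pi fun n => (annihilate s d n f).continuous.comp (continuous_apply (n + 1))

lemma continuous_aDag (f : OneBody d) : Continuous (aDag (s := s) f) := by
  refine continuous_pi fun n => ?_
  cases n with
  | zero => exact continuous_const
  | succ n => exact (create s d n f).continuous.comp (continuous_apply n)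

/-- The bounded operators on a Hilbert space `E`, with the topology and module structure of `E` read
off from its norm and inner product. -/
abbrev BddOp (E : Type*) [NormedAddCommGroup E] [InnerProductSpace ℂ E] : Type _ := E →L[ℂ] E

/-- The annihilation operator on the truncated Fock space. -/
def truncA (s : Statistics) (d N : ℕ) (f : OneBody d) : BddOp (TruncFock s d N) :=
  ⟨TruncFock.proj ∘ₗ aOp f ∘ₗ TruncFock.incl,
    continuous_proj.comp ((continuous_aOp f).comp continuous_incl)⟩

/-- The creation operator on the truncated Fock space, which annihilates the sector with `N`
particles. -/
def truncADag (s : Statistics) (d N : ℕ) (f : OneBody d) : BddOp (TruncFock s d N) :=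
  ⟨TruncFock.proj ∘ₗ aDag f ∘ₗ TruncFock.incl,
    continuous_proj.comp ((continuous_aDag f).comp continuous_incl)⟩

lemma truncA_apply (f : OneBody d) (Φ : TruncFock s d N) (n : Fin (N + 1)) :
    truncA s d N f Φ n = annihilate s d n f (TruncFock.incl Φ (n + 1)) := rfl

lemma truncADag_apply (f : OneBody d) (Φ : TruncFock s d N) (n : Fin (N + 1)) :
    truncADag s d N f Φ n = aDag f (TruncFock.incl Φ) n := rfl

lemma incl_truncA (f : OneBody d) (Φ : TruncFock s d N) :
    TruncFock.incl (truncA s d N f Φ) = aOp f (TruncFock.incl Φ) := by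
  funext n
  rcases le_or_gt n N with h | h
  · rw [incl_apply_of_le _ h, truncA_apply, aOp_apply]
  · rw [incl_apply_of_lt _ h, aOp_apply, incl_apply_of_lt _ (h.trans (Nat.lt_succ_self n)), map_zero]

lemma proj_aDag (f : OneBody d) (Φ : FockSeq s d) :
    (TruncFock.proj (aDag f Φ) : TruncFock s d N) = truncADag s d N f (TruncFock.proj Φ) := by
  ext1 ⟨n, hn⟩
  rw [proj_apply, truncADag_apply]
  cases n with
  | zero => rfl
  | succ n =>
    simp only [aDag_succ]
    rw [incl_apply_of_le _ (by omega), proj_apply]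

lemma truncFock_inner (Φ Ψ : TruncFock s d N) :
    ⟪Φ, Ψ⟫_ℂ = ∑ n : Fin (N + 1), ⟪Φ n, Ψ n⟫_ℂ := PiLp.inner_apply Φ Ψ

lemma adjoint_truncA (f : OneBody d) : adjoint (truncA s d N f) = truncADag s d N f := by
  refine ((eq_adjoint_iff _ _).2 fun Φ Ψ => ?_).symm
  rw [truncFock_inner, truncFock_inner, Fin.sum_univ_succ, Fin.sum_univ_castSucc]
  have h0 : ⟪truncADag s d N f Φ 0, Ψ 0⟫_ℂ = 0 := by
    rw [truncADag_apply]
    exact inner_zero_left _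
  have hN : ⟪Φ (Fin.last N), truncA s d N f Ψ (Fin.last N)⟫_ℂ = 0 := by
    rw [truncA_apply, incl_apply_of_lt _ (by simp), map_zero, inner_zero_right]
  rw [h0, hN, zero_add, add_zero]
  refine Finset.sum_congr rfl fun i _ => ?_
  rw [truncADag_apply, truncA_apply]
  have h1 : TruncFock.incl Φ (i : ℕ) = Φ i.castSucc := incl_apply_of_le Φ (by omega)
  have h2 : TruncFock.incl Ψ (i + 1 : ℕ) = Ψ i.succ := incl_apply_of_le Ψ (by omega)
  exact (congrArg₂ (fun x y => ⟪create s d i f x, y⟫_ℂ) h1 rfl).trans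
    ((inner_create_left f _ _).trans (congrArg (fun y => ⟪Φ i.castSucc, annihilate s d i f y⟫_ℂ)
      h2.symm))

/-- `a(g_p) ⋯ a(g₁)` on the truncated Fock space. -/
def truncString (s : Statistics) (d N : ℕ) :
    (p : ℕ) → (Fin p → OneBody d) → BddOp (TruncFock s d N)
  | 0, _ => 1
  | p + 1, g => truncString s d N p (fun i => g i.succ) * truncA s d N (g 0)

lemma truncString_succ (p : ℕ) (g : Fin (p + 1) → OneBody d) (Φ : TruncFock s d N) :
    truncString s d N (p + 1) g Φ =
      truncString s d N p (fun i => g i.succ) (truncA s d N (g 0) Φ) := rfl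

lemma incl_truncString (p : ℕ) (g : Fin p → OneBody d) (Φ : TruncFock s d N) :
    TruncFock.incl (truncString s d N p g Φ) = annihilationString p g (TruncFock.incl Φ) := by
  induction p generalizing Φ with
  | zero => rfl
  | succ p ih => rw [truncString_succ, ih, incl_truncA, annihilationString_succ]

lemma truncString_apply (p : ℕ) (g : Fin p → OneBody d) (Φ : TruncFock s d N) (n : Fin (N + 1)) :
    truncString s d N p g Φ n = annihilationString p g (TruncFock.incl Φ) n := by
  rw [← incl_truncString, incl_apply_fin]

lemma proj_creationString (q : ℕ) (f : Fin q → OneBody d) (Φ : FockSeq s d) :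
    (TruncFock.proj (creationString q f Φ) : TruncFock s d N) =
      adjoint (truncString s d N q f) (TruncFock.proj Φ) := by
  induction q with
  | zero =>
    have : adjoint (truncString s d N 0 f) = 1 := star_one (BddOp (TruncFock s d N))
    rw [this]
    rfl
  | succ q ih =>
    have : truncString s d N (q + 1) f =
      truncString s d N q (fun i => f i.succ) ∘L truncA s d N (f 0) := rfl
    rw [this, adjoint_comp, creationString_succ, proj_aDag, ih, adjoint_truncA]
    rfl

/-- The operator `a†(f₁) ⋯ a†(f_q) a(g_p) ⋯ a(g₁)` of the definition of the density matrices,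
compressed to the truncated Fock space. -/
lemma proj_creationString_annihilationString (p q : ℕ) (f : Fin q → OneBody d)
    (g : Fin p → OneBody d) (Φ : TruncFock s d N) :
    TruncFock.proj (creationString q f (annihilationString p g (TruncFock.incl Φ))) =
      (adjoint (truncString s d N q f) ∘L truncString s d N p g) Φ := by
  rw [proj_creationString, ← incl_truncString, proj_incl]
  rfl

end Truncated

/-! ### Existence and uniqueness of the density matrices -/

section DensityMatrix

open ContinuousLinearMap

variable {s : Statistics} {d N : ℕ}

/-- A positive operator of finite trace is `∑ |ξ i⟩⟨ξ i|`, with `ξ i` the images of an orthonormal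
basis under the square root of the operator. -/
lemma exists_nuclearRep_of_isPositive {E : Type} [NormedAddCommGroup E] [InnerProductSpace ℂ E]
    [CompleteSpace E] {T : BddOp E} (hT : T.IsPositive) {t : ℝ} (ht : HasTrace T t) :
    ∃ (A : Type) (ξ : A → E), NuclearRep T ξ ξ ∧ HasSum (fun a => ‖ξ a‖ ^ 2) t := by
  obtain ⟨w, b, -⟩ := exists_hilbertBasis ℂ E
  set S : BddOp E := CFC.sqrt T
  have hT0 : 0 ≤ T := (nonneg_iff_isPositive _).2 hT
  have hS : ∀ x, S (S x) = T x := fun x =>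
    congrArg (fun R : BddOp E => R x) (CFC.sqrt_mul_sqrt_self T hT0)
  have hSa : adjoint S = S := ((nonneg_iff_isPositive _).1 (CFC.sqrt_nonneg T)).isSelfAdjoint
  have hSi : ∀ x y, ⟪S x, y⟫_ℂ = ⟪x, S y⟫_ℂ := fun x y => by
    rw [← adjoint_inner_left, hSa]
  have hsq : HasSum (fun i => ‖S (b i)‖ ^ 2) t := by
    have := ht w b
    rw [← Complex.hasSum_ofReal]
    refine this.congr_fun fun i => ?_
    rw [← inner_self_eq_ofReal, hSi, hS]
  refine ⟨w, fun i => S (b i), ⟨hsq.summable, hsq.summable, fun x => ?_⟩, hsq⟩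
  have := S.hasSum (b.hasSum_repr (S x))
  rw [hS] at this
  refine this.congr_fun fun i => ?_
  rw [map_smul, b.repr_apply_apply, hSi]

/-- A bound on the vectors that represent the `p`-particle density matrices: the sum over `n ≤ N` of
the number `(p+n)! / (p! n!)` of ways to trace out `n` of `p + n` particles. -/
def densityBound (N p : ℕ) : ℝ :=
  ∑ n : Fin (N + 1), (((p + n).factorial : ℝ) / p.factorial) / (n : ℕ).factorial

lemma densityBound_nonneg (N p : ℕ) : 0 ≤ densityBound N p :=
  Finset.sum_nonneg fun _ _ => by positivity

variable {ι A : Type} (e : HilbertBasis ι ℂ (OneBody d)) (ξ : A → TruncFock s d N)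

/-- The `p`-particle component of `a(e_{K n}) ⋯ a(e_{K 1}) ξ`, normalised by `1/√n!`: the vector `ξ`
after `n` of its particles have been removed in the states `e_K`. -/
def partialVec (p : ℕ) (z : A × (Σ n : Fin (N + 1), Fin n → ι)) : nBody s d p :=
  (((Real.sqrt (z.2.1 : ℕ).factorial)⁻¹ : ℝ) : ℂ) •
    annihilationString (z.2.1 : ℕ) (fun i => e (z.2.2 i)) (TruncFock.incl (ξ z.1)) p

lemma norm_sq_partialVec (p : ℕ) (a : A) (n : Fin (N + 1)) (K : Fin n → ι) :
    ‖partialVec e ξ p (a, ⟨n, K⟩)‖ ^ 2 = ((n : ℕ).factorial : ℝ)⁻¹ *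
      ‖annihilationString (n : ℕ) (fun i => e (K i)) (TruncFock.incl (ξ a)) p‖ ^ 2 := by
  rw [partialVec, norm_smul, mul_pow, Complex.norm_real, Real.norm_eq_abs, sq_abs, inv_pow,
    Real.sq_sqrt (by positivity)]

lemma hasSum_sigma_of_nonneg {α : Type*} [Fintype α] {β : α → Type*} {f : (Σ a, β a) → ℝ}
    {g : α → ℝ} (hf : ∀ z, 0 ≤ f z) (hg : ∀ x, HasSum (fun y => f ⟨x, y⟩) (g x)) :
    HasSum f (∑ x, g x) := by
  have hs : Summable f := by
    rw [summable_sigma_of_nonneg hf]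
    exact ⟨fun x => (hg x).summable, (hasSum_fintype _).summable⟩
  rw [(hasSum_fintype g).unique (hs.hasSum.sigma hg)]
  exact hs.hasSum

lemma hasSum_norm_sq_partialVec (hξ : HasSum (fun a => ‖ξ a‖ ^ 2) 1) (p : ℕ) :
    (Summable fun z => ‖partialVec e ξ p z‖ ^ 2) ∧
      ∑' z, ‖partialVec e ξ p z‖ ^ 2 ≤ densityBound N p := by
  set c : A → ℝ := fun a => ∑ n : Fin (N + 1), ((n : ℕ).factorial : ℝ)⁻¹ *
    (((p + n).factorial : ℝ) / p.factorial * ‖TruncFock.incl (ξ a) (p + n)‖ ^ 2) with hc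
  have hfib : ∀ a, HasSum (fun y => ‖partialVec e ξ p (a, y)‖ ^ 2) (c a) := fun a => by
    refine hasSum_sigma_of_nonneg (fun _ => by positivity) fun n => ?_
    simp only [norm_sq_partialVec]
    exact (hasSum_norm_sq_annihilationString e n p (p + n) rfl _).mul_left _
  have hle : ∀ a, c a ≤ densityBound N p * ‖ξ a‖ ^ 2 := fun a => by
    rw [hc, densityBound, Finset.sum_mul]
    refine Finset.sum_le_sum fun n _ => ?_
    rw [← mul_assoc, inv_mul_eq_div]
    gcongr
    exact norm_incl_apply_le _ _
  have hc0 : ∀ a, 0 ≤ c a := fun a => Finset.sum_nonneg fun _ _ => by positivity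
  have hcs : Summable c := .of_nonneg_of_le hc0 hle (hξ.summable.mul_left _)
  have := hasSum_prod_of_nonneg (f := fun z => ‖partialVec e ξ p z‖ ^ 2)
    (fun _ => by positivity) hfib hcs.hasSum
  refine ⟨this.summable, ?_⟩
  rw [this.tsum_eq]
  refine (hcs.tsum_le_tsum hle (hξ.summable.mul_left _)).trans ?_
  rw [tsum_mul_left, hξ.tsum_eq, mul_one]

lemma exchange_pow_mul_self (s : Statistics) (n : ℕ) : s.exchange ^ n * s.exchange ^ n = 1 := by
  rw [← mul_pow, s.exchange_mul_self, one_pow]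

lemma norm_exchange_pow (s : Statistics) (n : ℕ) : ‖s.exchange ^ n‖ = 1 := by
  cases s <;> simp [Statistics.exchange]

/-- Removing first the particles in the states `k` and then those in the states `g`, or the other
way round, gives the same up to a sign. -/
lemma inner_prodVec_annihilationString (n p : ℕ) (k : Fin n → OneBody d) (g : Fin p → OneBody d)
    (Φ : FockSeq s d) :
    ⟪prodVec s d p g, annihilationString n k Φ p⟫_ℂ =
      s.exchange ^ (n * p) * ⟪prodVec s d n k, annihilationString p g Φ n⟫_ℂ := by
  rw [inner_prodVec, inner_prodVec, annihilationString_comm p n, Pi.smul_apply,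
    nBody_inner_smul_right]

/-- The partial traces of `∑ |ξ a⟩⟨ξ a|` over `n ≤ N` particles, summed over `n`, give an operator
with the matrix elements of the density matrix. -/
lemma exists_partialTrace (hξ : HasSum (fun a => ‖ξ a‖ ^ 2) 1) (p q : ℕ) :
    ∃ (D : nBody s d q →L[ℂ] nBody s d p) (B : Type) (u : B → nBody s d q) (v : B → nBody s d p),
      NuclearRep D u v ∧ ∑' z, ‖u z‖ ^ 2 ≤ densityBound N q ∧ ∑' z, ‖v z‖ ^ 2 ≤ densityBound N p ∧
      ∀ f g, HasSum (fun a => ⟪truncString s d N q f (ξ a), truncString s d N p g (ξ a)⟫_ℂ)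
        ⟪prodVec s d p g, D (prodVec s d q f)⟫_ℂ := by
  obtain ⟨w, e, -⟩ := exists_hilbertBasis ℂ (OneBody d)
  -- The sign makes up for moving the `n` annihilation operators of the partial trace past the `p`
  -- operators on one side and the `q` operators on the other.
  set v : A × (Σ n : Fin (N + 1), Fin n → w) → nBody s d p :=
    fun z => s.exchange ^ ((z.2.1 : ℕ) * p + z.2.1 * q) • partialVec e ξ p z with hv
  have hvn : ∀ z, ‖v z‖ ^ 2 = ‖partialVec e ξ p z‖ ^ 2 := fun z => by
    rw [hv, norm_smul, norm_exchange_pow, one_mul]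
  have hus := hasSum_norm_sq_partialVec e ξ hξ q
  have hvs := hasSum_norm_sq_partialVec e ξ hξ p
  simp only [← hvn] at hvs
  obtain ⟨D, hD⟩ := exists_nuclearRep hus.1 hvs.1
  refine ⟨D, _, partialVec e ξ q, v, hD, hus.2, hvs.2, fun f g => ?_⟩
  have hs := hD.inner_hasSum (prodVec s d q f) (prodVec s d p g)
  refine hs.prod_fiberwise fun a => ?_
  have hfs := hs.summable.prod_factor a
  rw [truncFock_inner]
  refine (hfs.hasSum_iff.2 ?_)
  rw [hfs.tsum_sigma, tsum_fintype]
  refine Finset.sum_congr rfl fun n _ => ?_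
  rw [truncString_apply, truncString_apply]
  have := (hasSum_inner_prodVec_mul e (n : ℕ) (annihilationString q f (TruncFock.incl (ξ a)) n)
    (annihilationString p g (TruncFock.incl (ξ a)) n)).mul_left (((n : ℕ).factorial : ℂ)⁻¹)
  rw [← mul_assoc, inv_mul_cancel₀ (by exact_mod_cast (n : ℕ).factorial_ne_zero), one_mul] at this
  rw [← this.tsum_eq]
  refine tsum_congr fun K => ?_
  have h1 : (((Real.sqrt (n : ℕ).factorial)⁻¹ : ℝ) : ℂ) * (((Real.sqrt (n : ℕ).factorial)⁻¹ : ℝ) : ℂ) =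
      ((n : ℕ).factorial : ℂ)⁻¹ := by
    rw [← Complex.ofReal_mul, ← mul_inv, Real.mul_self_sqrt (by positivity)]
    simp
  simp only [hv, partialVec]
  rw [nBody_inner_smul_left, nBody_inner_smul_right, nBody_inner_smul_right, Complex.conj_ofReal,
    inner_prodVec_annihilationString, ← inner_conj_symm (annihilationString _ _ _ _) (prodVec s d q f),
    inner_prodVec_annihilationString, ← inner_conj_symm (annihilationString q f _ _), map_mul, map_pow,
    s.conj_exchange, ← h1, pow_add]
  have key : ∀ r x y c c' : ℂ, c * c = 1 → c' * c' = 1 →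
      r * (c' * x) * (c * c' * (r * (c * y))) = r * r * (x * y) := by
    intro r x y c c' hc hc'
    linear_combination (r * r * x * y) * (c' * c' * hc + hc')
  exact key _ _ _ _ _ (exchange_pow_mul_self s (n * p)) (exchange_pow_mul_self s (n * q))

lemma State.exists_nuclearRep (Γ : State s d N) :
    ∃ (A : Type) (ξ : A → TruncFock s d N), NuclearRep Γ.op ξ ξ ∧ HasSum (fun a => ‖ξ a‖ ^ 2) 1 :=
  exists_nuclearRep_of_isPositive (E := TruncFock s d N) Γ.isPositive (by
    rw [Complex.ofReal_one]; exact Γ.hasTrace_one)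

variable {ξ} in
lemma NuclearRep.hasTrace_strings {Γ : State s d N} (h : NuclearRep Γ.op ξ ξ) {p q : ℕ}
    (f : Fin q → OneBody d) (g : Fin p → OneBody d) :
    HasTrace (fun Φ : TruncFock s d N => Γ.op (TruncFock.proj
      (creationString q f (annihilationString p g (TruncFock.incl Φ)))))
      (∑' a, ⟪truncString s d N q f (ξ a), truncString s d N p g (ξ a)⟫_ℂ) := by
  have := h.hasTrace_comp (adjoint (truncString s d N q f) ∘L truncString s d N p g)
  rw [nuclearPairing_apply] at this
  simp only [coe_comp, Function.comp_apply, adjoint_inner_right] at this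
  simp only [proj_creationString_annihilationString]
  exact this

lemma IsDensityMatrix.unique {Γ : State s d N} {p q : ℕ} {D D' : nBody s d q →L[ℂ] nBody s d p}
    (h : IsDensityMatrix Γ p q D) (h' : IsDensityMatrix Γ p q D') : D = D' :=
  ext_of_inner_prodVec fun f g => (h f g).unique (h' f g)

/-- The density matrices exist, and they are trace class with bounds that do not depend on the
state. -/
lemma State.exists_isDensityMatrix (Γ : State s d N) (p q : ℕ) :
    ∃ D, IsDensityMatrix Γ p q D ∧ ∃ (B : Type) (u : B → nBody s d q) (v : B → nBody s d p),
      NuclearRep D u v ∧ ∑' z, ‖u z‖ ^ 2 ≤ densityBound N q + densityBound N p ∧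
      ∑' z, ‖v z‖ ^ 2 ≤ densityBound N q + densityBound N p := by
  obtain ⟨A, ξ, hΓ, hξ⟩ := Γ.exists_nuclearRep
  obtain ⟨D, B, u, v, hD, hu, hv, hfg⟩ := exists_partialTrace ξ hξ p q
  refine ⟨D, fun f g => ?_, B, u, v, hD, hu.trans ?_, hv.trans ?_⟩
  · rw [← (hfg f g).tsum_eq]
    exact hΓ.hasTrace_strings f g
  · linarith [densityBound_nonneg N p]
  · linarith [densityBound_nonneg N q]

lemma isDensityMatrix_densityMatrix (Γ : State s d N) (p q : ℕ) :
    IsDensityMatrix Γ p q (densityMatrix Γ p q) := by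
  have h : ∃ D, IsDensityMatrix Γ p q D := (Γ.exists_isDensityMatrix p q).imp fun _ h => h.1
  rw [densityMatrix, dif_pos h]
  exact h.choose_spec

lemma exists_nuclearRep_densityMatrix (Γ : State s d N) (p q : ℕ) :
    ∃ (B : Type) (u : B → nBody s d q) (v : B → nBody s d p),
      NuclearRep (densityMatrix Γ p q) u v ∧
      ∑' z, ‖u z‖ ^ 2 ≤ densityBound N q + densityBound N p ∧
      ∑' z, ‖v z‖ ^ 2 ≤ densityBound N q + densityBound N p := by
  obtain ⟨D, hD, h⟩ := Γ.exists_isDensityMatrix p q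
  rwa [hD.unique (isDensityMatrix_densityMatrix Γ p q)] at h

lemma norm_inner_densityMatrix_le (Γ : State s d N) (p q : ℕ) (ψ : nBody s d p)
    (ψ' : nBody s d q) : ‖⟪ψ, densityMatrix Γ p q ψ'⟫_ℂ‖ ≤
      (densityBound N q + densityBound N p) * ‖ψ'‖ * ‖ψ‖ := by
  obtain ⟨B, u, v, h, hu, hv⟩ := exists_nuclearRep_densityMatrix Γ p q
  exact h.norm_inner_le hu hv ψ' ψ

lemma inner_prodVec_densityMatrix {Γ : State s d N} (h : NuclearRep Γ.op ξ ξ) {p q : ℕ}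
    (f : Fin q → OneBody d) (g : Fin p → OneBody d) :
    ⟪prodVec s d p g, densityMatrix Γ p q (prodVec s d q f)⟫_ℂ =
      ∑' a, ⟪truncString s d N q f (ξ a), truncString s d N p g (ξ a)⟫_ℂ :=
  (isDensityMatrix_densityMatrix Γ p q f g).unique (h.hasTrace_strings f g)

end DensityMatrix

/-! ### The sectors of the truncated Fock space -/

section Sectors

open ContinuousLinearMap

variable {s : Statistics} {d N : ℕ}

lemma bddOp_mul_apply {E : Type*} [NormedAddCommGroup E] [InnerProductSpace ℂ E] (S T : BddOp E)
    (x : E) : (S * T) x = S (T x) := rfl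

/-- The projection onto the sector with `n` particles; it vanishes for `n > N`. -/
def sectorProj (s : Statistics) (d N n : ℕ) : BddOp (TruncFock s d N) :=
  ⟨TruncFock.proj ∘ₗ LinearMap.single ℂ (fun m : ℕ => nBody s d m) n ∘ₗ
      LinearMap.proj n ∘ₗ TruncFock.incl,
    continuous_proj.comp ((continuous_single n).comp ((continuous_apply n).comp continuous_incl))⟩

lemma sectorProj_apply (n : ℕ) (Φ : TruncFock s d N) (m : Fin (N + 1)) :
    sectorProj s d N n Φ m = Pi.single (M := fun m : ℕ => nBody s d m) n (TruncFock.incl Φ n) m := rfl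

lemma sectorProj_apply_self (n : Fin (N + 1)) (Φ : TruncFock s d N) :
    sectorProj s d N n Φ n = Φ n := by
  rw [sectorProj_apply, Pi.single_eq_same, incl_apply_fin]

lemma sectorProj_apply_of_ne {n : ℕ} {m : Fin (N + 1)} (h : (m : ℕ) ≠ n) (Φ : TruncFock s d N) :
    sectorProj s d N n Φ m = 0 := by
  rw [sectorProj_apply, Pi.single_eq_of_ne h]

lemma incl_sectorProj (n : ℕ) (Φ : TruncFock s d N) :
    TruncFock.incl (sectorProj s d N n Φ) = Pi.single n (TruncFock.incl Φ n) := by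
  funext m
  rcases le_or_gt m N with h | h
  · rw [incl_apply_of_le _ h, sectorProj_apply]
  · rw [incl_apply_of_lt _ h]
    by_cases hm : m = n
    · subst hm
      rw [Pi.single_eq_same, incl_apply_of_lt _ h]
    · rw [Pi.single_eq_of_ne hm]

lemma sectorProj_of_lt {n : ℕ} (h : N < n) : sectorProj s d N n = 0 := by
  ext1 Φ
  ext1 m
  exact sectorProj_apply_of_ne (by omega) Φ

lemma adjoint_sectorProj (n : ℕ) : adjoint (sectorProj s d N n) = sectorProj s d N n := by
  refine ((eq_adjoint_iff _ _).2 fun Φ Ψ => ?_).symm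
  rw [truncFock_inner, truncFock_inner]
  refine Finset.sum_congr rfl fun m _ => ?_
  by_cases h : (m : ℕ) = n
  · subst h
    rw [sectorProj_apply_self, sectorProj_apply_self]
  · rw [sectorProj_apply_of_ne h, sectorProj_apply_of_ne h, inner_zero_left, inner_zero_right]

lemma sectorProj_mul_self (n : ℕ) :
    sectorProj s d N n * sectorProj s d N n = sectorProj s d N n := by
  ext1 Φ
  ext1 m
  rw [bddOp_mul_apply, sectorProj_apply, incl_sectorProj, Pi.single_eq_same, sectorProj_apply]

lemma sectorProj_mul_of_ne {n m : ℕ} (h : n ≠ m) :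
    sectorProj s d N n * sectorProj s d N m = 0 := by
  ext1 Φ
  ext1 k
  rw [bddOp_mul_apply, sectorProj_apply, incl_sectorProj, Pi.single_eq_of_ne h, Pi.single_zero]
  rfl

lemma sum_sectorProj : ∑ n : Fin (N + 1), sectorProj s d N n = 1 := by
  ext1 Φ
  ext1 m
  rw [sum_apply]
  have : (∑ n : Fin (N + 1), sectorProj s d N n Φ) m = ∑ n : Fin (N + 1), sectorProj s d N n Φ m := by
    simp
  rw [this, Finset.sum_eq_single m, sectorProj_apply_self]
  · rfl
  · intro n _ hn
    exact sectorProj_apply_of_ne (fun h => hn (Fin.ext h.symm)) Φ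
  · simp

lemma truncA_mul_sectorProj_succ (f : OneBody d) (n : ℕ) :
    truncA s d N f * sectorProj s d N (n + 1) = sectorProj s d N n * truncA s d N f := by
  ext1 Φ
  ext1 m
  rw [bddOp_mul_apply, bddOp_mul_apply, truncA_apply, incl_sectorProj, sectorProj_apply, incl_truncA, aOp_apply]
  by_cases h : (m : ℕ) = n
  · subst h
    rw [Pi.single_eq_same, Pi.single_eq_same]
  · rw [Pi.single_eq_of_ne h, Pi.single_eq_of_ne (by omega), map_zero]

lemma truncA_mul_sectorProj_zero (f : OneBody d) :
    truncA s d N f * sectorProj s d N 0 = 0 := by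
  ext1 Φ
  ext1 m
  rw [bddOp_mul_apply, truncA_apply, incl_sectorProj, Pi.single_eq_of_ne (by omega), map_zero]
  rfl

lemma truncADag_mul_sectorProj (f : OneBody d) (n : ℕ) :
    truncADag s d N f * sectorProj s d N n = sectorProj s d N (n + 1) * truncADag s d N f := by
  have h := congrArg star (truncA_mul_sectorProj_succ (s := s) (N := N) f n)
  rw [star_mul, star_mul, star_eq_adjoint, star_eq_adjoint, star_eq_adjoint, adjoint_sectorProj,
    adjoint_sectorProj, adjoint_truncA] at h
  exact h.symm

lemma incl_truncADag_apply {f : OneBody d} {Φ : TruncFock s d N} {n : ℕ} (h : n ≤ N) :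
    TruncFock.incl (truncADag s d N f Φ) n = aDag f (TruncFock.incl Φ) n := by
  rw [incl_apply_of_le _ h, truncADag_apply]

/-- The canonical (anti)commutation relations hold below the highest sector. -/
lemma truncA_mul_truncADag (f g : OneBody d) {n : ℕ} (hn : n < N) :
    truncA s d N f * truncADag s d N g * sectorProj s d N n =
      ⟪f, g⟫_ℂ • sectorProj s d N n +
        s.exchange • (truncADag s d N g * truncA s d N f * sectorProj s d N n) := by
  ext1 Φ
  ext1 m
  rw [add_apply, smul_apply, smul_apply]
  change truncA s d N f (truncADag s d N g (sectorProj s d N n Φ)) m =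
    ⟪f, g⟫_ℂ • sectorProj s d N n Φ m +
      s.exchange • truncADag s d N g (truncA s d N f (sectorProj s d N n Φ)) m
  rw [truncADag_apply, incl_truncA, truncA_apply, sectorProj_apply, ← incl_sectorProj]
  set Ψ := sectorProj s d N n Φ with hΨ
  by_cases hm : (m : ℕ) = n
  · rw [incl_truncADag_apply (by omega), aDag_succ]
    obtain ⟨m, hmN⟩ := m
    cases m with
    | zero =>
      rw [annihilate_create_zero, aDag_zero]
      exact ((congrArg _ (smul_zero s.exchange)).trans (add_zero _)).symm
    | succ m => exact annihilate_create f g _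
  · have h0 : ∀ k, k ≠ n → TruncFock.incl Ψ k = 0 := fun k hk => by
      rw [hΨ, incl_sectorProj, Pi.single_eq_of_ne hk]
    have h1 : TruncFock.incl (truncADag s d N g Ψ) (m + 1) = 0 := by
      rcases le_or_gt ((m : ℕ) + 1) N with h | h
      · rw [incl_truncADag_apply h, aDag_succ, h0 _ hm, map_zero]
      · exact incl_apply_of_lt _ h
    have h2 : aDag g (aOp f (TruncFock.incl Ψ)) m = 0 := by
      obtain ⟨m, hmN⟩ := m
      cases m with
      | zero => rfl
      | succ m => rw [aDag_succ, aOp_apply, h0 _ hm, map_zero, map_zero]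
    rw [h1, h2, h0 _ hm, map_zero, smul_zero, smul_zero, add_zero]

/-- The expansion of `a(h) (g₁ ∘ ⋯ ∘ g_r)`. -/
lemma annihilate_prodVec (r : ℕ) (h : OneBody d) (g : Fin (r + 1) → OneBody d) :
    annihilate s d r h (prodVec s d (r + 1) g) = ∑ i : Fin (r + 1),
      (s.exchange ^ (i : ℕ) * ⟪h, g i⟫_ℂ) • prodVec s d r (fun k => g (i.succAbove k)) := by
  induction r with
  | zero =>
    rw [prodVec_succ, annihilate_create_zero]
    simp [prodVec]
  | succ r ih =>
    rw [prodVec_succ, annihilate_create, ih, map_sum, Finset.smul_sum, eq_comm, Fin.sum_univ_succ,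
      eq_comm]
    congr 1
    · simp
    · refine Finset.sum_congr rfl fun i _ => ?_
      rw [map_smul, smul_smul, prodVec_succ]
      simp only [Fin.val_succ, pow_succ', mul_assoc, Fin.succ_succAbove_zero,
        Fin.succ_succAbove_succ]

end Sectors

/-! ### Representations of the operators on the truncated Fock space -/

section Representation

open ContinuousLinearMap

variable {s : Statistics} {d N : ℕ} {𝒦 : Type} [NormedAddCommGroup 𝒦] [InnerProductSpace ℂ 𝒦]
  [CompleteSpace 𝒦] (π : BddOp (TruncFock s d N) →⋆ₐ[ℂ] BddOp 𝒦)

lemma rep_add (a b : BddOp (TruncFock s d N)) (x : 𝒦) : π (a + b) x = π a x + π b x :=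
  congrArg (fun T : BddOp 𝒦 => T x) (π.map_add' a b)

lemma rep_mul (a b : BddOp (TruncFock s d N)) (x : 𝒦) : π (a * b) x = π a (π b x) :=
  congrArg (fun T : BddOp 𝒦 => T x) (π.map_mul' a b)

lemma rep_smul (c : ℂ) (a : BddOp (TruncFock s d N)) (x : 𝒦) : π (c • a) x = c • π a x :=
  congrArg (fun T : BddOp 𝒦 => T x) (π.toAlgHom.toLinearMap.map_smul c a)

lemma rep_zero (x : 𝒦) : π 0 x = 0 :=
  congrArg (fun T : BddOp 𝒦 => T x) π.map_zero'

lemma adjoint_rep (a : BddOp (TruncFock s d N)) : adjoint (π a) = π (adjoint a) :=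
  (map_star π a).symm

lemma inner_rep_truncADag (f : OneBody d) (x y : 𝒦) :
    ⟪π (truncADag s d N f) x, y⟫_ℂ = ⟪x, π (truncA s d N f) y⟫_ℂ := by
  rw [← adjoint_truncA, ← adjoint_rep, adjoint_inner_left]

lemma rep_truncA_of_succ (f : OneBody d) {n : ℕ} {x : 𝒦}
    (hx : π (sectorProj s d N (n + 1)) x = x) :
    π (sectorProj s d N n) (π (truncA s d N f) x) = π (truncA s d N f) x := by
  conv_rhs => rw [← hx]
  rw [← rep_mul, ← rep_mul, truncA_mul_sectorProj_succ]

lemma rep_truncA_of_zero (f : OneBody d) {x : 𝒦} (hx : π (sectorProj s d N 0) x = x) :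
    π (truncA s d N f) x = 0 := by
  rw [← hx, ← rep_mul, truncA_mul_sectorProj_zero, rep_zero]

lemma rep_truncADag_mem (f : OneBody d) {n : ℕ} {x : 𝒦} (hx : π (sectorProj s d N n) x = x) :
    π (sectorProj s d N (n + 1)) (π (truncADag s d N f) x) = π (truncADag s d N f) x := by
  conv_rhs => rw [← hx]
  rw [← rep_mul, ← rep_mul, truncADag_mul_sectorProj]

lemma rep_truncA_truncADag (f g : OneBody d) {n : ℕ} (hn : n < N) {x : 𝒦}
    (hx : π (sectorProj s d N n) x = x) :
    π (truncA s d N f) (π (truncADag s d N g) x) =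
      ⟪f, g⟫_ℂ • x + s.exchange • π (truncADag s d N g) (π (truncA s d N f) x) := by
  have h := congrArg (fun a => π a x) (truncA_mul_truncADag f g hn)
  simp only [rep_add, rep_smul, rep_mul, hx] at h
  exact h

/-- The vectors with `l` particles on which all annihilation operators vanish. In the Fock space
these are the multiples of the vacuum, with `l = 0`; an arbitrary representation may have such
vectors for every `l ≤ N`. -/
def generalizedVacua (l : ℕ) : Submodule ℂ 𝒦 where
  carrier := {x | π (sectorProj s d N l) x = x ∧ ∀ f, π (truncA s d N f) x = 0}
  add_mem' {x y} hx hy := ⟨by rw [map_add, hx.1, hy.1], fun f => by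
    rw [map_add, hx.2, hy.2, add_zero]⟩
  zero_mem' := ⟨map_zero _, fun f => map_zero _⟩
  smul_mem' c x hx := ⟨by rw [map_smul, hx.1], fun f => by rw [map_smul, hx.2, smul_zero]⟩

lemma isClosed_generalizedVacua (l : ℕ) : IsClosed (generalizedVacua π l : Set 𝒦) := by
  have : (generalizedVacua π l : Set 𝒦) =
      {x | π (sectorProj s d N l) x = x} ∩ ⋂ f, {x | π (truncA s d N f) x = 0} := by
    ext x
    simp [generalizedVacua]
  rw [this]
  exact (isClosed_eq (by fun_prop) (by fun_prop)).inter
    (isClosed_iInter fun f => isClosed_eq (by fun_prop) (by fun_prop))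

instance (l : ℕ) : CompleteSpace (generalizedVacua π l) :=
  (isClosed_generalizedVacua π l).completeSpace_coe

/-- `a†(f₁) ⋯ a†(f_q)` in the representation `π`. -/
def repCreation : (q : ℕ) → (Fin q → OneBody d) → BddOp 𝒦
  | 0, _ => 1
  | q + 1, f => π (truncADag s d N (f 0)) * repCreation q (fun i => f i.succ)

lemma repCreation_zero (f : Fin 0 → OneBody d) (x : 𝒦) : repCreation π 0 f x = x := rfl

lemma repCreation_succ (q : ℕ) (f : Fin (q + 1) → OneBody d) (x : 𝒦) :
    repCreation π (q + 1) f x =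
      π (truncADag s d N (f 0)) (repCreation π q (fun i => f i.succ) x) := rfl

lemma repCreation_mem {l : ℕ} {x : 𝒦} (hx : π (sectorProj s d N l) x = x) (q : ℕ)
    (f : Fin q → OneBody d) :
    π (sectorProj s d N (l + q)) (repCreation π q f x) = repCreation π q f x := by
  induction q with
  | zero => exact hx
  | succ q ih => exact rep_truncADag_mem π _ (ih _)

lemma repCreation_of_lt {l : ℕ} {x : 𝒦} (hx : π (sectorProj s d N l) x = x) {q : ℕ}
    (h : N < l + q) (f : Fin q → OneBody d) : repCreation π q f x = 0 := by
  rw [← repCreation_mem π hx, sectorProj_of_lt h, rep_zero]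

variable {π}

/-- On generalized vacua, the annihilation operators act on strings of creation operators as they
act on products of one-body functions in the Fock space. -/
lemma rep_truncA_repCreation {l : ℕ} {y : 𝒦} (hy : y ∈ generalizedVacua π l) (r : ℕ)
    (hr : l + r + 1 ≤ N) (h : OneBody d) (g : Fin (r + 1) → OneBody d) :
    π (truncA s d N h) (repCreation π (r + 1) g y) = ∑ i : Fin (r + 1),
      (s.exchange ^ (i : ℕ) * ⟪h, g i⟫_ℂ) • repCreation π r (fun k => g (i.succAbove k)) y := by
  induction r with
  | zero =>
    rw [repCreation_succ, repCreation_zero, rep_truncA_truncADag π _ _ (by omega) hy.1, hy.2]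
    simp [repCreation_zero]
  | succ r ih =>
    rw [repCreation_succ, rep_truncA_truncADag π _ _ (by omega) (repCreation_mem π hy.1 _ _),
      ih (by omega), map_sum, Finset.smul_sum, eq_comm, Fin.sum_univ_succ, eq_comm]
    congr 1
    · simp
    · refine Finset.sum_congr rfl fun i _ => ?_
      rw [map_smul, smul_smul, repCreation_succ]
      simp only [Fin.val_succ, pow_succ', mul_assoc, Fin.succ_succAbove_zero,
        Fin.succ_succAbove_succ]

/-- On generalized vacua, the inner products of strings of creation operators are those of the
product vectors of the Fock space. -/
lemma inner_repCreation {l : ℕ} (x : 𝒦) {y : 𝒦} (hy : y ∈ generalizedVacua π l) (q : ℕ)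
    (hq : l + q ≤ N) (f g : Fin q → OneBody d) :
    ⟪repCreation π q f x, repCreation π q g y⟫_ℂ =
      ⟪prodVec s d q f, prodVec s d q g⟫_ℂ * ⟪x, y⟫_ℂ := by
  induction q with
  | zero =>
    rw [repCreation_zero, repCreation_zero]
    simp only [prodVec]
    rw [inner_vacuum_vacuum, one_mul]
  | succ q ih =>
    rw [repCreation_succ, inner_rep_truncADag, rep_truncA_repCreation hy _ (by omega), prodVec_succ,
      inner_create_left, annihilate_prodVec, inner_sum, inner_sum, Finset.sum_mul]
    refine Finset.sum_congr rfl fun i _ => ?_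
    rw [nBody_inner_smul_right, mul_assoc, ← ih (by omega)]
    exact inner_smul_right _ _ _

/-- After `r` creations, more than `r` annihilations bring a generalized vacuum to zero, even though
it may contain particles. -/
lemma inner_repCreation_of_lt {l : ℕ} {x y : 𝒦} (hy : y ∈ generalizedVacua π l) {q r : ℕ}
    (hr : l + r ≤ N) (h : r < q) (f : Fin q → OneBody d) (g : Fin r → OneBody d) :
    ⟪repCreation π q f x, repCreation π r g y⟫_ℂ = 0 := by
  induction q generalizing r with
  | zero => omega
  | succ q ih =>
    rw [repCreation_succ, inner_rep_truncADag]
    cases r with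
    | zero => rw [repCreation_zero, hy.2, inner_zero_right]
    | succ r =>
      rw [rep_truncA_repCreation hy _ (by omega), inner_sum]
      refine Finset.sum_eq_zero fun i _ => (inner_smul_right (𝕜 := ℂ) _ _ _).trans ?_
      exact mul_eq_zero_of_right _ (ih (by omega) (by omega) _ _)

lemma inner_repCreation_of_ne {l l' : ℕ} {x y : 𝒦} (hx : x ∈ generalizedVacua π l')
    (hy : y ∈ generalizedVacua π l) {q r : ℕ} (hq : l' + q ≤ N)
    (hr : l + r ≤ N) (h : q ≠ r) (f : Fin q → OneBody d) (g : Fin r → OneBody d) :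
    ⟪repCreation π q f x, repCreation π r g y⟫_ℂ = 0 := by
  rcases h.lt_or_gt with h | h
  · exact inner_eq_zero_symm.1 (inner_repCreation_of_lt hx hq h g f)
  · exact inner_repCreation_of_lt hy hr h f g

/-- A unit vector among the generalized vacua generates a copy of each sector of the Fock space
that the bound on the number of particles leaves room for. -/
lemma exists_isometry_of_mem_generalizedVacua {l q : ℕ} (hq : l + q ≤ N) {y : 𝒦}
    (hy : y ∈ generalizedVacua π l) (hn : ‖y‖ = 1) :
    ∃ U : nBody s d q →ₗᵢ[ℂ] 𝒦, ∀ f, U (prodVec s d q f) = repCreation π q f y := by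
  set e := Finsupp.linearCombination ℂ (fun f : Fin q → OneBody d => repCreation π q f y) with he
  have hin : ∀ c c', ⟪e c, e c'⟫_ℂ = ⟪prodVecLin s d q c, prodVecLin s d q c'⟫_ℂ := by
    intro c c'
    rw [he, prodVecLin, Finsupp.linearCombination_apply, Finsupp.linearCombination_apply,
      Finsupp.linearCombination_apply, Finsupp.linearCombination_apply]
    simp only [Finsupp.sum]
    rw [sum_inner, sum_inner]
    refine Finset.sum_congr rfl fun f _ => ?_
    rw [inner_sum, inner_sum]
    refine Finset.sum_congr rfl fun g _ => ?_
    rw [nBody_inner_smul_left, nBody_inner_smul_right]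
    refine (inner_smul_left (𝕜 := ℂ) _ _ _).trans ?_
    congr 1
    refine (inner_smul_right (𝕜 := ℂ) _ _ _).trans ?_
    congr 1
    refine (inner_repCreation y hy q hq f g).trans ?_
    rw [inner_self_eq_ofReal, hn]
    simp
  obtain ⟨U, hU⟩ := exists_linearIsometry_of_norm_eq (prodVecLin s d q) e (denseRange_prodVecLin q)
    fun c => by
      have := hin c c
      rw [inner_self_eq_ofReal, inner_self_eq_ofReal] at this
      exact (sq_eq_sq₀ (norm_nonneg _) (norm_nonneg _)).1 (Complex.ofReal_injective this)
  refine ⟨U, fun f => ?_⟩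
  rw [← prodVecLin_single, hU, he]
  simp

/-- The generalized vacua generate the whole space: in the sector with `n` particles, a vector
orthogonal to everything generated has, by induction on `n`, vanishing annihilations, and so it is a
generalized vacuum itself. -/
lemma eq_zero_of_inner_repCreation_eq_zero {x : 𝒦}
    (hx : ∀ l q, l + q ≤ N → ∀ y ∈ generalizedVacua π l, ∀ f, ⟪repCreation π q f y, x⟫_ℂ = 0) :
    x = 0 := by
  have key : ∀ n ≤ N, ∀ z, π (sectorProj s d N n) z = z → (∀ l q, l + q = n →
      ∀ y ∈ generalizedVacua π l, ∀ f, ⟪repCreation π q f y, z⟫_ℂ = 0) → z = 0 := by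
    intro n
    induction n with
    | zero =>
      intro _ z hz h
      exact (inner_self_eq_zero (𝕜 := ℂ)).1
        (h 0 0 rfl z ⟨hz, fun f => rep_truncA_of_zero π f hz⟩ Fin.elim0)
    | succ n ih =>
      intro hn z hz h
      have ha : ∀ f, π (truncA s d N f) z = 0 := fun f => by
        refine ih (by omega) _ (rep_truncA_of_succ π f hz) fun l q hlq y hy g => ?_
        rw [← inner_rep_truncADag]
        exact h l (q + 1) (by omega) y hy (Fin.cons f g)
      exact (inner_self_eq_zero (𝕜 := ℂ)).1 (h (n + 1) 0 rfl z ⟨hz, ha⟩ Fin.elim0)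
  have hP : ∀ n ≤ N, π (sectorProj s d N n) x = 0 := fun n hn => by
    refine key n hn _ ?_ fun l q hlq y hy f => ?_
    · rw [← rep_mul, sectorProj_mul_self]
    · rw [← adjoint_inner_left, adjoint_rep, adjoint_sectorProj, ← hlq, repCreation_mem π hy.1]
      exact hx l q (by omega) y hy f
  have h1 := congrArg (fun a => π a x) (sum_sectorProj (s := s) (d := d) (N := N))
  simp only [map_sum, map_one, sum_apply] at h1
  refine h1.symm.trans (Finset.sum_eq_zero fun n _ => hP n (Nat.le_of_lt_succ n.2))

end Representation

/-! ### Decomposition of a representation into truncated Fock spaces -/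

section Intertwiners

open ContinuousLinearMap

variable {s : Statistics} {d N : ℕ} {𝒦 : Type} [NormedAddCommGroup 𝒦] [InnerProductSpace ℂ 𝒦]
  [CompleteSpace 𝒦] {π : BddOp (TruncFock s d N) →⋆ₐ[ℂ] BddOp 𝒦}

lemma truncString_of_intertwines {Ξ : 𝒦 → TruncFock s d N}
    (hΞ : ∀ h x, truncA s d N h (Ξ x) = Ξ (π (truncA s d N h) x)) (p : ℕ)
    (g : Fin p → OneBody d) (x : 𝒦) :
    truncString s d N p g (Ξ x) = Ξ (π (truncString s d N p g) x) := by
  induction p generalizing x with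
  | zero =>
    have : π (truncString s d N 0 g) = 1 := map_one π
    rw [this]
    rfl
  | succ p ih =>
    have : π (truncString s d N (p + 1) g) =
      π (truncString s d N p fun i => g i.succ) * π (truncA s d N (g 0)) := map_mul π _ _
    rw [truncString_succ, hΞ, ih, this, bddOp_mul_apply]

/-- The components in the Fock space of the vectors of `𝒦`, seen from a unit vector `y` among the
generalized vacua: the adjoints of the isometries generated by `y`. -/
lemma exists_components {l : ℕ} {y : 𝒦} (hy : y ∈ generalizedVacua π l) (hn : ‖y‖ = 1) :
    ∃ T : ∀ q, 𝒦 →L[ℂ] nBody s d q,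
      (∀ q f x, ⟪prodVec s d q f, T q x⟫_ℂ = ⟪repCreation π q f y, x⟫_ℂ) ∧
      ∀ q, l + q ≤ N → ∃ U : nBody s d q →ₗᵢ[ℂ] 𝒦,
        (∀ f, U (prodVec s d q f) = repCreation π q f y) ∧
        T q = adjoint U.toContinuousLinearMap := by
  choose U hU using fun (q : ℕ) (hq : l + q ≤ N) => exists_isometry_of_mem_generalizedVacua hq hy hn
  refine ⟨fun q => if hq : l + q ≤ N then adjoint (U q hq).toContinuousLinearMap else 0,
    fun q f x => ?_, fun q hq => ⟨U q hq, hU q hq, dif_pos hq⟩⟩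
  by_cases hq : l + q ≤ N
  · simp only [dif_pos hq]
    rw [adjoint_inner_right, ← hU q hq]
    rfl
  · simp only [dif_neg hq]
    rw [repCreation_of_lt π hy.1 (by omega), inner_zero_left]
    exact inner_zero_right _

/-- An orthonormal family of generalized vacua, complete for each number of particles. -/
lemma exists_orthonormal_generalizedVacua (π : BddOp (TruncFock s d N) →⋆ₐ[ℂ] BddOp 𝒦) :
    ∃ (J : Type) (l : J → ℕ) (v : J → 𝒦), (∀ j, v j ∈ generalizedVacua π (l j)) ∧
      (∀ j, ‖v j‖ = 1) ∧ (∀ i j, i ≠ j → ⟪v i, v j⟫_ℂ = 0) ∧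
      ∀ x, (∀ j q, l j + q ≤ N → ∀ f, ⟪repCreation π q f (v j), x⟫_ℂ = 0) → x = 0 := by
  choose w b hb using fun l : Fin (N + 1) => exists_hilbertBasis ℂ (generalizedVacua π l)
  refine ⟨Σ l, w l, fun j => j.1, fun j => (b j.1 j.2 : 𝒦), fun j => (b j.1 j.2).2,
    fun j => (b j.1).orthonormal.1 j.2, ?_, fun x hx => ?_⟩
  · rintro ⟨l, i⟩ ⟨l', j⟩ hij
    by_cases hl : l = l'
    · subst hl
      exact (b l).orthonormal.2 fun h => hij (congrArg (Sigma.mk l) h)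
    · have h1 := (b l i).2.1
      have h2 := (b l' j).2.1
      dsimp only
      rw [← h1, ← h2, ← adjoint_inner_right, adjoint_rep, adjoint_sectorProj,
        ← rep_mul, sectorProj_mul_of_ne fun h => hl (Fin.ext h), rep_zero]
      exact inner_zero_right _
  · refine eq_zero_of_inner_repCreation_eq_zero (π := π) fun l q hlq y hy f => ?_
    let L : Fin (N + 1) := ⟨l, by omega⟩
    have h0 : ∀ i : w L, ⟪x, repCreation π q f (b L i)⟫_ℂ = 0 := fun i =>
      inner_eq_zero_symm.1 (hx ⟨L, i⟩ q hlq f)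
    have h1 := ((b L).hasSum_repr ⟨y, hy⟩).mapL
      (innerSL ℂ x ∘L repCreation π q f ∘L (generalizedVacua π L).subtypeL)
    refine inner_eq_zero_symm.1 (h1.unique ?_)
    refine hasSum_zero.congr_fun fun i => ?_
    rw [map_smul]
    exact (congrArg _ (h0 i)).trans (smul_zero _)

/-- The isometric copies of the sectors generated by an orthonormal family of generalized vacua are
orthogonal to each other and span the whole space. -/
lemma hasSum_inner_components {J : Type} {l : J → ℕ} {v : J → 𝒦}
    (hvm : ∀ j, v j ∈ generalizedVacua π (l j)) (hvo : ∀ i j, i ≠ j → ⟪v i, v j⟫_ℂ = 0)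
    (hx : ∀ x, (∀ j q, l j + q ≤ N → ∀ f, ⟪repCreation π q f (v j), x⟫_ℂ = 0) → x = 0)
    {T : ∀ (_ : J) q, 𝒦 →L[ℂ] nBody s d q}
    (hT : ∀ j q f x, ⟪prodVec s d q f, T j q x⟫_ℂ = ⟪repCreation π q f (v j), x⟫_ℂ)
    (hTU : ∀ j q, l j + q ≤ N → ∃ U : nBody s d q →ₗᵢ[ℂ] 𝒦,
      (∀ f, U (prodVec s d q f) = repCreation π q f (v j)) ∧
      T j q = adjoint U.toContinuousLinearMap) (x y : 𝒦) :
    HasSum (fun z : J × Fin (N + 1) => ⟪T z.1 z.2 x, T z.1 z.2 y⟫_ℂ) ⟪x, y⟫_ℂ := by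
  choose U hU hUT using hTU
  let I : Type := {z : J × Fin (N + 1) // l z.1 + z.2 ≤ N}
  let V : ∀ z : I, nBody s d z.1.2 →ₗᵢ[ℂ] 𝒦 := fun z => U z.1.1 z.1.2 z.2
  have hVT : ∀ z : I, adjoint (V z).toContinuousLinearMap = T z.1.1 z.1.2 :=
    fun z => (hUT z.1.1 z.1.2 z.2).symm
  have hV : OrthogonalFamily ℂ (fun z : I => nBody s d z.1.2) V := by
    intro z z' hz x y
    have hD : adjoint (V z).toContinuousLinearMap ∘L (V z').toContinuousLinearMap = 0 := by
      refine ext_of_inner_prodVec fun f g => ?_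
      rw [coe_comp, Function.comp_apply, adjoint_inner_right]
      refine Eq.trans ?_ (inner_zero_right _).symm
      change ⟪U z.1.1 z.1.2 z.2 (prodVec s d z.1.2 g),
        U z'.1.1 z'.1.2 z'.2 (prodVec s d z'.1.2 f)⟫_ℂ = 0
      rw [hU, hU]
      by_cases hqr : (z.1.2 : ℕ) = z'.1.2
      · have hne : z.1.1 ≠ z'.1.1 := fun h => hz (Subtype.ext (Prod.ext h (Fin.ext hqr)))
        have hr := z'.2
        revert f
        rw [← hqr] at hr ⊢
        intro f
        rw [inner_repCreation _ (hvm _) _ hr, hvo _ _ hne, mul_zero]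
      · exact inner_repCreation_of_ne (hvm _) (hvm _) z.2 z'.2 hqr _ _
    have := congrArg (fun S => ⟪x, S y⟫_ℂ) hD
    simp only [coe_comp, Function.comp_apply, adjoint_inner_right] at this
    exact this.trans (inner_zero_right _)
  have htot : ∀ x, (∀ z : I, adjoint (V z).toContinuousLinearMap x = 0) → x = 0 :=
    fun x h => hx x fun j q hjq f => by
      have h1 := h ⟨(j, ⟨q, by omega⟩), hjq⟩
      rw [hVT] at h1
      rw [← hT, h1]
      exact inner_zero_right _
  refine (Function.Injective.hasSum_iff (g := (Subtype.val : I → J × Fin (N + 1)))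
    Subtype.val_injective fun z hz => ?_).1
    ((hasSum_inner_adjoint V hV htot x y).congr_fun fun z => ?_)
  · have h0 : T z.1 z.2 x = 0 := eq_zero_of_inner_prodVec_eq_zero fun f => by
      rw [hT, repCreation_of_lt π (hvm z.1).1 (by by_contra h; exact hz ⟨⟨z, by omega⟩, rfl⟩),
        inner_zero_left]
    rw [h0]
    exact inner_zero_left _
  · rw [hVT]
    rfl

/-- The number of particles being bounded, a representation of the operators on the truncated Fock
space decomposes into truncated Fock spaces: there is a Parseval family of maps into the truncated
Fock space that intertwine the annihilation operators. -/
theorem exists_intertwiners (π : BddOp (TruncFock s d N) →⋆ₐ[ℂ] BddOp 𝒦) :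
    ∃ (J : Type) (Ξ : J → 𝒦 → TruncFock s d N),
      (∀ x y, HasSum (fun j => ⟪Ξ j x, Ξ j y⟫_ℂ) ⟪x, y⟫_ℂ) ∧
      ∀ j h x, truncA s d N h (Ξ j x) = Ξ j (π (truncA s d N h) x) := by
  obtain ⟨J, l, v, hvm, hvn, hvo, htot⟩ := exists_orthonormal_generalizedVacua π
  choose T hT hTU using fun j => exists_components (hvm j) (hvn j)
  have hT0 : ∀ j q, N < q → ∀ x, T j q x = 0 := fun j q h x =>
    eq_zero_of_inner_prodVec_eq_zero fun f => by
      rw [hT, repCreation_of_lt π (hvm j).1 (by omega), inner_zero_left]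
  refine ⟨J, fun j x => TruncFock.proj fun q => T j q x, fun x y => ?_, fun j h x => ?_⟩
  · refine ((hasSum_inner_components hvm hvo htot hT hTU x y).prod_fiberwise
      fun j => hasSum_fintype _).congr_fun fun j => ?_
    rw [truncFock_inner]
    rfl
  · have hincl : ∀ m : ℕ,
        TruncFock.incl (TruncFock.proj (N := N) fun q => T j q x) m = T j m x := by
      intro m
      rcases le_or_gt m N with hm | hm
      · rw [incl_apply_of_le _ hm]
        rfl
      · rw [incl_apply_of_lt _ hm, hT0 j m hm]
    ext1 m
    rw [truncA_apply, hincl, proj_apply]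
    refine sub_eq_zero.1 (eq_zero_of_inner_prodVec_eq_zero fun g => ?_)
    rw [inner_sub_right, ← inner_create_left, hT, ← inner_rep_truncADag, sub_eq_zero]
    exact hT j (m + 1) (Fin.cons h g) x

end Intertwiners

/-! ### States from positive functionals -/

section Realization

open ContinuousLinearMap

variable {s : Statistics} {d N : ℕ}

/-- The vectors of a representation give states on the truncated Fock space with the same matrix
elements of the products of creation and annihilation operators, by adding up the projections onto
their components in the truncated Fock spaces that the representation is made of. -/
lemma exists_state_of_rep {𝒦 : Type} [NormedAddCommGroup 𝒦] [InnerProductSpace ℂ 𝒦]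
    [CompleteSpace 𝒦] (π : BddOp (TruncFock s d N) →⋆ₐ[ℂ] BddOp 𝒦) (Ψ : 𝒦) (hΨ : ‖Ψ‖ = 1) :
    ∃ Γ : State s d N, ∀ (p q : ℕ) f g,
      ⟪prodVec s d p g, densityMatrix Γ p q (prodVec s d q f)⟫_ℂ =
        ⟪π (truncString s d N q f) Ψ, π (truncString s d N p g) Ψ⟫_ℂ := by
  obtain ⟨J, Ξ, hΞ, hΞa⟩ := exists_intertwiners π
  have hn : HasSum (fun j => ‖Ξ j Ψ‖ ^ 2) 1 := by
    have := (hΞ Ψ Ψ).mapL Complex.reCLM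
    simp only [inner_self_eq_ofReal, Complex.reCLM_apply, Complex.ofReal_re, hΨ, one_pow] at this
    exact this
  obtain ⟨D, hD⟩ := exists_nuclearRep hn.summable hn.summable
  have hin : ∀ x, ⟪x, D x⟫_ℂ = ((∑' j, ‖⟪Ξ j Ψ, x⟫_ℂ‖ ^ 2 : ℝ) : ℂ) := fun x => by
    rw [← (hD.inner_hasSum x x).tsum_eq, Complex.ofReal_tsum]
    refine tsum_congr fun j => ?_
    rw [Complex.ofReal_pow, ← Complex.mul_conj']
    exact congrArg _ (inner_conj_symm (𝕜 := ℂ) (E := TruncFock s d N) x (Ξ j Ψ)).symm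
  have hpos : ContinuousLinearMap.IsPositive (𝕜 := ℂ) (E := TruncFock s d N) D := by
    refine (isPositive_iff_complex _).2 fun x => ?_
    have h1 : ⟪D x, x⟫_ℂ = ((∑' j, ‖⟪Ξ j Ψ, x⟫_ℂ‖ ^ 2 : ℝ) : ℂ) := by
      refine (inner_conj_symm (𝕜 := ℂ) (E := TruncFock s d N) (D x) x).symm.trans ?_
      refine (congrArg _ (hin x)).trans (Complex.conj_ofReal _)
    have h2 : (0 : ℝ) ≤ ∑' j, ‖⟪Ξ j Ψ, x⟫_ℂ‖ ^ 2 := tsum_nonneg fun _ => by positivity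
    constructor
    · exact (congrArg (fun z : ℂ => (z.re : ℂ)) h1).trans
        ((congrArg Complex.ofReal (Complex.ofReal_re _)).trans h1.symm)
    · exact h2.trans_eq (congrArg Complex.re h1).symm
  have htr : HasTrace D 1 := by
    have h1 := hD.hasTrace
    rwa [(hΞ Ψ Ψ).tsum_eq, inner_self_eq_ofReal, hΨ, one_pow, Complex.ofReal_one] at h1
  refine ⟨⟨D, hpos, htr⟩, fun p q f g => ?_⟩
  rw [inner_prodVec_densityMatrix (fun j => Ξ j Ψ) hD]
  simp only [truncString_of_intertwines (hΞa _)]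
  exact (hΞ _ _).tsum_eq

open scoped ComplexOrder in
/-- The cyclic vector of the Gelfand–Naimark–Segal representation. -/
lemma exists_gns_vector {A : Type*} [CStarAlgebra A] [PartialOrder A] [StarOrderedRing A]
    (φ : A →ₚ[ℂ] ℂ) (h1 : φ 1 = 1) : ∃ Ψ : φ.GNS, ‖Ψ‖ = 1 ∧
      ∀ a b, ⟪φ.gnsStarAlgHom a Ψ, φ.gnsStarAlgHom b Ψ⟫_ℂ = φ (star a * b) := by
  have hπ : ∀ a, φ.gnsStarAlgHom a (φ.toPreGNS 1 : φ.PreGNS) =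
      ((φ.toPreGNS a : φ.PreGNS) : φ.GNS) := fun a => by
    refine (PositiveLinearMap.gnsNonUnitalStarAlgHom_apply_coe φ).trans ?_
    rw [PositiveLinearMap.leftMulMapPreGNS_apply]
    simp
  refine ⟨(φ.toPreGNS 1 : φ.PreGNS), ?_, fun a b => ?_⟩
  · rw [UniformSpace.Completion.norm_coe, PositiveLinearMap.preGNS_norm_def]
    simp [h1]
  · rw [hπ, hπ]
    exact UniformSpace.Completion.inner_coe _ _

/-- The Gelfand–Naimark–Segal representation. -/
lemma exists_rep_of_positive {A : Type} [CStarAlgebra A] [PartialOrder A] [StarOrderedRing A]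
    (ω : A →ₗ[ℂ] ℂ) (hω : ∀ X, 0 ≤ X → 0 ≤ (ω X).re ∧ (ω X).im = 0) (h1 : ω 1 = 1) :
    ∃ (𝒦 : Type) (_ : NormedAddCommGroup 𝒦) (_ : InnerProductSpace ℂ 𝒦) (_ : CompleteSpace 𝒦)
      (π : A →⋆ₐ[ℂ] (𝒦 →L[ℂ] 𝒦)) (Ψ : 𝒦), ‖Ψ‖ = 1 ∧
      ∀ a b, ⟪π a Ψ, π b Ψ⟫_ℂ = ω (star a * b) := by
  open scoped ComplexOrder in
  let φ : A →ₚ[ℂ] ℂ := PositiveLinearMap.mk₀ ω fun X hX =>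
    Complex.nonneg_iff.2 ⟨(hω X hX).1, (hω X hX).2.symm⟩
  obtain ⟨Ψ, hΨ, hin⟩ := exists_gns_vector φ h1
  exact ⟨φ.GNS, inferInstance, inferInstance, inferInstance, φ.gnsStarAlgHom, Ψ, hΨ, hin⟩

lemma exists_bddOp_rep_of_positive {E : Type} [NormedAddCommGroup E] [InnerProductSpace ℂ E]
    [CompleteSpace E] (ω : BddOp E →ₗ[ℂ] ℂ)
    (hω : ∀ X, 0 ≤ X → 0 ≤ (ω X).re ∧ (ω X).im = 0) (h1 : ω 1 = 1) :
    ∃ (𝒦 : Type) (_ : NormedAddCommGroup 𝒦) (_ : InnerProductSpace ℂ 𝒦) (_ : CompleteSpace 𝒦)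
      (π : BddOp E →⋆ₐ[ℂ] BddOp 𝒦) (Ψ : 𝒦), ‖Ψ‖ = 1 ∧
      ∀ a b, ⟪π a Ψ, π b Ψ⟫_ℂ = ω (star a * b) :=
  exists_rep_of_positive (A := BddOp E) ω hω h1

/-- A positive functional on the operators on the truncated Fock space need not be given by a trace,
but some state has the same matrix elements of the products of creation and annihilation
operators. The state obtained differs from the functional on other operators: particles lost at
infinity appear in the functional as particles of generalized vacua. -/
lemma exists_state_of_positive (ω : BddOp (TruncFock s d N) →ₗ[ℂ] ℂ)
    (hω : ∀ X, 0 ≤ X → 0 ≤ (ω X).re ∧ (ω X).im = 0) (h1 : ω 1 = 1) :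
    ∃ Γ : State s d N, ∀ (p q : ℕ) f g,
      ⟪prodVec s d p g, densityMatrix Γ p q (prodVec s d q f)⟫_ℂ =
        ω (star (truncString s d N q f) * truncString s d N p g) := by
  obtain ⟨𝒦, _, _, _, π, Ψ, hΨ, hin⟩ :=
    exists_bddOp_rep_of_positive (E := TruncFock s d N) ω hω h1
  obtain ⟨Γ, hΓ⟩ := exists_state_of_rep (s := s) (d := d) (N := N) π Ψ hΨ
  exact ⟨Γ, fun p q f g => (hΓ p q f g).trans (hin _ _)⟩

end Realization

/-! ### Compactness of the set of states -/

section Limits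

open ContinuousLinearMap

variable {s : Statistics} {d N : ℕ}

/-- The expectation values in a state. -/
lemma State.exists_functional (Γ : State s d N) :
    ∃ φ : BddOp (TruncFock s d N) →ₗ[ℂ] ℂ, (∀ X, ‖φ X‖ ≤ ‖X‖) ∧
      (∀ X, 0 ≤ X → 0 ≤ (φ X).re ∧ (φ X).im = 0) ∧ φ 1 = 1 ∧ ∀ (p q : ℕ) f g,
      ⟪prodVec s d p g, densityMatrix Γ p q (prodVec s d q f)⟫_ℂ =
        φ (star (truncString s d N q f) * truncString s d N p g) := by
  obtain ⟨A, ξ, hΓ, hξ⟩ := Γ.exists_nuclearRep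
  refine ⟨nuclearPairing hΓ.summable_left hΓ.summable_right, fun X => ?_, fun X hX => ?_, ?_,
    fun p q f g => ?_⟩
  · have := norm_nuclearPairing_le hΓ.summable_left hΓ.summable_right hξ.tsum_eq.le hξ.tsum_eq.le X
    rwa [one_mul] at this
  · have hX' := (nonneg_iff_isPositive X).1 hX
    have h0 : ∀ a, 0 ≤ (⟪ξ a, X (ξ a)⟫_ℂ).re ∧ 0 = (⟪ξ a, X (ξ a)⟫_ℂ).im := fun a =>
      Complex.nonneg_iff.1 (hX'.inner_nonneg_right (ξ a))
    have h1 : ∀ a, ⟪ξ a, X (ξ a)⟫_ℂ = (((⟪ξ a, X (ξ a)⟫_ℂ).re : ℝ) : ℂ) :=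
      fun a => Complex.ext rfl (h0 a).2.symm
    rw [nuclearPairing_apply, tsum_congr h1, ← Complex.ofReal_tsum]
    refine ⟨?_, Complex.ofReal_im _⟩
    rw [Complex.ofReal_re]
    exact tsum_nonneg fun a => (h0 a).1
  · rw [nuclearPairing_apply]
    have h1 : ∀ a, ⟪ξ a, (1 : BddOp (TruncFock s d N)) (ξ a)⟫_ℂ = ((‖ξ a‖ ^ 2 : ℝ) : ℂ) :=
      fun a => inner_self_eq_ofReal (ξ a)
    rw [tsum_congr h1, ← Complex.ofReal_tsum, hξ.tsum_eq, Complex.ofReal_one]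
  · rw [inner_prodVec_densityMatrix ξ hΓ, nuclearPairing_apply]
    refine tsum_congr fun a => ?_
    rw [star_eq_adjoint, bddOp_mul_apply]
    exact (adjoint_inner_right _ _ _).symm

/-- Along an ultrafilter, the expectation values of states converge to a positive functional, so that
the density matrices converge to those of a state. -/
lemma exists_limit_state (F : Ultrafilter (State s d N)) :
    ∃ Γ₀ : State s d N, ∀ (p q : ℕ) f g,
      Tendsto (fun Γ => ⟪prodVec s d p g, densityMatrix Γ p q (prodVec s d q f)⟫_ℂ) (F : Filter (State s d N))
        (𝓝 ⟪prodVec s d p g, densityMatrix Γ₀ p q (prodVec s d q f)⟫_ℂ) := by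
  choose φ hφn hφp hφ1 hφ using fun Γ : State s d N => Γ.exists_functional
  have hlim : ∀ X, ∃ z, Tendsto (fun Γ => φ Γ X) F (𝓝 z) := fun X => by
    obtain ⟨z, -, hz⟩ := (isCompact_closedBall (0 : ℂ) ‖X‖).ultrafilter_le_nhds
      (F.map fun Γ => φ Γ X) (by
        refine tendsto_principal.2 (Eventually.of_forall fun Γ => ?_)
        simpa using hφn Γ X)
    exact ⟨z, hz⟩
  choose ω hω using hlim
  let ω' : BddOp (TruncFock s d N) →ₗ[ℂ] ℂ :=
    { toFun := ω
      map_add' := fun X Y => by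
        refine tendsto_nhds_unique (hω (X + Y)) ?_
        simp only [map_add]
        exact (hω X).add (hω Y)
      map_smul' := fun c X => by
        refine tendsto_nhds_unique (hω (c • X)) ?_
        simp only [map_smul]
        exact (hω X).const_smul c }
  have hpos : ∀ X, 0 ≤ X → 0 ≤ (ω' X).re ∧ (ω' X).im = 0 := fun X hX => by
    refine ⟨?_, ?_⟩
    · exact ge_of_tendsto' ((Complex.continuous_re.tendsto _).comp (hω X)) fun Γ =>
        (hφp Γ X hX).1
    · refine tendsto_nhds_unique ((Complex.continuous_im.tendsto _).comp (hω X)) ?_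
      exact tendsto_const_nhds.congr fun Γ => (hφp Γ X hX).2.symm
  have h1 : ω' 1 = 1 := by
    refine tendsto_nhds_unique (hω 1) ?_
    simp only [hφ1]
    exact tendsto_const_nhds
  obtain ⟨Γ₀, hΓ₀⟩ := exists_state_of_positive ω' hpos h1
  refine ⟨Γ₀, fun p q f g => ?_⟩
  rw [hΓ₀]
  simp only [hφ]
  exact hω _

/-- Weak convergence of uniformly bounded operators may be checked on dense sets. -/
lemma tendsto_inner_of_dense {X Y : Type*} [NormedAddCommGroup X] [InnerProductSpace ℂ X]
    [NormedAddCommGroup Y] [InnerProductSpace ℂ Y] {α : Type*} {F : Filter α} {D : α → X →L[ℂ] Y}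
    {D₀ : X →L[ℂ] Y} {C : ℝ} (hC : 0 ≤ C) (hD : ∀ a x y, ‖⟪y, D a x⟫_ℂ‖ ≤ C * ‖x‖ * ‖y‖)
    {S : Set X} {T : Set Y} (hS : Dense S) (hT : Dense T)
    (h : ∀ x ∈ S, ∀ y ∈ T, Tendsto (fun a => ⟪y, D a x⟫_ℂ) F (𝓝 ⟪y, D₀ x⟫_ℂ)) (x : X) (y : Y) :
    Tendsto (fun a => ⟪y, D a x⟫_ℂ) F (𝓝 ⟪y, D₀ x⟫_ℂ) := by
  have h1 : ∀ y ∈ T, ∀ x, Tendsto (fun a => ⟪y, D a x⟫_ℂ) F (𝓝 ⟪y, D₀ x⟫_ℂ) := by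
    intro y hy x
    have he : Equicontinuous fun a x => ⟪y, D a x⟫_ℂ :=
      (LipschitzWith.uniformEquicontinuous _ (C * ‖y‖).toNNReal fun a =>
        LipschitzWith.of_dist_le_mul fun x x' => by
          rw [dist_eq_norm, dist_eq_norm, ← inner_sub_right, ← map_sub,
            Real.coe_toNNReal _ (by positivity)]
          exact (hD a _ y).trans_eq (by ring)).equicontinuous
    exact (he.isClosed_setOfPred_tendsto (f := fun x => ⟪y, D₀ x⟫_ℂ)
      (by fun_prop)).closure_subset_iff.2 (fun x hx => h x hx y hy) (hS x)
  have he : Equicontinuous fun a y => ⟪y, D a x⟫_ℂ :=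
    (LipschitzWith.uniformEquicontinuous _ (C * ‖x‖).toNNReal fun a =>
      LipschitzWith.of_dist_le_mul fun y y' => by
        rw [dist_eq_norm, dist_eq_norm, ← inner_sub_left, Real.coe_toNNReal _ (by positivity)]
        exact hD a x _).equicontinuous
  exact (he.isClosed_setOfPred_tendsto (f := fun y => ⟪y, D₀ x⟫_ℂ)
    (by fun_prop)).closure_subset_iff.2 (fun y hy => h1 y hy x) (hT y)

lemma tendsto_densityMatrix_of_dense {α : Type*} {F : Filter α} {Γ : α → State s d N}
    {Γ₀ : State s d N} {p q : ℕ} {S : Set (nBody s d p)} {T : Set (nBody s d q)} (hS : Dense S)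
    (hT : Dense T) (h : ∀ ψ ∈ S, ∀ ψ' ∈ T, Tendsto (fun a => ⟪ψ, densityMatrix (Γ a) p q ψ'⟫_ℂ) F
      (𝓝 ⟪ψ, densityMatrix Γ₀ p q ψ'⟫_ℂ)) (ψ : nBody s d p) (ψ' : nBody s d q) :
    Tendsto (fun a => ⟪ψ, densityMatrix (Γ a) p q ψ'⟫_ℂ) F
      (𝓝 ⟪ψ, densityMatrix Γ₀ p q ψ'⟫_ℂ) :=
  tendsto_inner_of_dense (add_nonneg (densityBound_nonneg N q) (densityBound_nonneg N p))
    (fun a x y => norm_inner_densityMatrix_le (Γ a) p q y x) hT hS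
    (fun x hx y hy => h y hy x hx) ψ' ψ

/-- Matrix elements between product vectors suffice for the convergence of density matrices. -/
lemma tendsto_densityMatrix_of_prodVec {α : Type*} {F : Filter α} {Γ : α → State s d N}
    {Γ₀ : State s d N} {p q : ℕ} (h : ∀ g f,
      Tendsto (fun a => ⟪prodVec s d p g, densityMatrix (Γ a) p q (prodVec s d q f)⟫_ℂ) F
        (𝓝 ⟪prodVec s d p g, densityMatrix Γ₀ p q (prodVec s d q f)⟫_ℂ))
    (ψ : nBody s d p) (ψ' : nBody s d q) :
    Tendsto (fun a => ⟪ψ, densityMatrix (Γ a) p q ψ'⟫_ℂ) F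
      (𝓝 ⟪ψ, densityMatrix Γ₀ p q ψ'⟫_ℂ) := by
  refine tendsto_densityMatrix_of_dense (denseRange_prodVecLin p) (denseRange_prodVecLin q)
    ?_ ψ ψ'
  rintro _ ⟨c, rfl⟩ _ ⟨c', rfl⟩
  have hexp : ∀ D : nBody s d q →L[ℂ] nBody s d p, ⟪prodVecLin s d p c, D (prodVecLin s d q c')⟫_ℂ =
      ∑ g ∈ c.support, ∑ f ∈ c'.support,
        starRingEnd ℂ (c g) * (c' f * ⟪prodVec s d p g, D (prodVec s d q f)⟫_ℂ) := fun D => by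
    rw [prodVecLin, prodVecLin, Finsupp.linearCombination_apply, Finsupp.linearCombination_apply]
    simp only [Finsupp.sum]
    rw [map_sum, sum_inner]
    refine Finset.sum_congr rfl fun g _ => ?_
    rw [inner_sum]
    refine Finset.sum_congr rfl fun f _ => ?_
    rw [map_smul, nBody_inner_smul_left, nBody_inner_smul_right]
  simp only [hexp]
  exact tendsto_finsetSum _ fun g _ => tendsto_finsetSum _ fun f _ =>
    ((h g f).const_mul _).const_mul _

lemma le_nhds_geometricTopology_iff {F : Filter (State s d N)} {Γ₀ : State s d N} :
    F ≤ @nhds _ (geometricTopology s d N) Γ₀ ↔ ∀ (p q : Fin (N + 1)) (ψ : nBody s d p)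
      (ψ' : nBody s d q), Tendsto (fun Γ => ⟪ψ, densityMatrix Γ p q ψ'⟫_ℂ) F
        (𝓝 ⟪ψ, densityMatrix Γ₀ p q ψ'⟫_ℂ) := by
  simp only [nhds_iInf, nhds_induced, le_iInf_iff, tendsto_iff_comap]

/-- Every ultrafilter of states converges. -/
theorem compactSpace_state (s : Statistics) (d N : ℕ) :
    @CompactSpace (State s d N) (geometricTopology s d N) := by
  let _ := geometricTopology s d N
  refine ⟨isCompact_iff_ultrafilter_le_nhds.2 fun F _ => ?_⟩
  obtain ⟨Γ₀, hΓ₀⟩ := exists_limit_state F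
  exact ⟨Γ₀, Set.mem_univ _, le_nhds_geometricTopology_iff.2 fun p q =>
    tendsto_densityMatrix_of_prodVec fun g f => hΓ₀ p q f g⟩

lemma separableSpace_nBody (s : Statistics) (d n : ℕ) :
    TopologicalSpace.SeparableSpace (nBody s d n) := by
  have : Fact ((2 : ENNReal) ≠ ⊤) := ⟨by simp⟩
  have : SecondCountableTopology (L2n d n) := inferInstance
  have : SecondCountableTopology (nBody s d n) :=
    TopologicalSpace.Subtype.secondCountableTopology _
  infer_instance

/-- The `n`-body spaces being separable and the density matrices bounded, countably many matrix
elements determine the geometric topology near a state. -/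
theorem firstCountableTopology_state (s : Statistics) (d N : ℕ) :
    @FirstCountableTopology (State s d N) (geometricTopology s d N) := by
  let _ := geometricTopology s d N
  refine ⟨fun Γ₀ => ?_⟩
  have hsep := fun n => separableSpace_nBody s d n
  choose S hSc hSd using fun n => TopologicalSpace.exists_countable_dense (nBody s d n)
  have hS : ∀ n, Countable (S n) := fun n => (hSc n).to_subtype
  set G : Filter (State s d N) := ⨅ (p : Fin (N + 1)) (q : Fin (N + 1)) (ψ : S p) (ψ' : S q),
    comap (fun Γ => ⟪(ψ : nBody s d p), densityMatrix Γ p q ψ'⟫_ℂ)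
      (𝓝 ⟪(ψ : nBody s d p), densityMatrix Γ₀ p q ψ'⟫_ℂ) with hG
  have hle : ∀ (p q : Fin (N + 1)) (ψ : S p) (ψ' : S q),
      Tendsto (fun Γ => ⟪(ψ : nBody s d p), densityMatrix Γ p q ψ'⟫_ℂ) G
        (𝓝 ⟪(ψ : nBody s d p), densityMatrix Γ₀ p q ψ'⟫_ℂ) := by
    simp only [tendsto_iff_comap, ← le_iInf_iff, hG, le_refl]
  have hn := le_nhds_geometricTopology_iff.1 (le_refl (𝓝 Γ₀))
  have h : 𝓝 Γ₀ = G := by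
    refine le_antisymm ?_ (le_nhds_geometricTopology_iff.2 fun p q => ?_)
    · simp only [hG, le_iInf_iff, ← tendsto_iff_comap]
      exact fun p q ψ ψ' => hn p q ψ ψ'
    · exact tendsto_densityMatrix_of_dense (Γ := fun Γ => Γ) (hSd p) (hSd q)
        fun ψ hψ ψ' hψ' => hle p q ⟨ψ, hψ⟩ ⟨ψ', hψ'⟩
  rw [h]
  infer_instance

theorem seqCompactSpace_state (s : Statistics) (d N : ℕ) :
    @SeqCompactSpace (State s d N) (geometricTopology s d N) := by
  let _ := geometricTopology s d N
  have := compactSpace_state s d N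
  have := firstCountableTopology_state s d N
  infer_instance

lemma geomTendsto_of_tendsto {Γ : ℕ → State s d N} {Γ₀ : State s d N}
    (h : Tendsto Γ atTop (@nhds _ (geometricTopology s d N) Γ₀)) : GeomTendsto Γ Γ₀ :=
  fun p hp q hq ψ ψ' => tendsto_map'_iff.1 (le_nhds_geometricTopology_iff.1 h
    ⟨p, Nat.lt_succ_of_le hp⟩ ⟨q, Nat.lt_succ_of_le hq⟩ ψ ψ')

/-- Geometric convergence is weak-* convergence of the density matrices, since their trace norms are
bounded. -/
lemma GeomTendsto.weakStarTendsto {Γ : ℕ → State s d N} {Γ₀ : State s d N} (h : GeomTendsto Γ Γ₀)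
    {p q : ℕ} (hp : p ≤ N) (hq : q ≤ N) :
    WeakStarTendsto (fun n => densityMatrix (Γ n) p q) (densityMatrix Γ₀ p q) :=
  weakStarTendsto_of_tendsto_inner (fun n => exists_nuclearRep_densityMatrix (Γ n) p q)
    (exists_nuclearRep_densityMatrix Γ₀ p q) fun x y => h p hp q hq y x

end Limits

end GeomFock

end

/-- Geometric compactness of the set of states on the truncated Fock space. The first part says that
the density matrices are well defined, the others that the set of states is compact and sequentially
compact for the geometric topology, every sequence of states having a subsequence that converges
geometrically to a state, and that all density matrices then converge weakly-* in the trace class. -/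
theorem mainTheorem11 (s : GeomFock.Statistics) (d N : ℕ) :
    (∀ (Γ : GeomFock.State s d N), ∀ p ≤ N, ∀ q ≤ N,
      GeomFock.IsDensityMatrix Γ p q (GeomFock.densityMatrix Γ p q) ∧
      ∀ D, GeomFock.IsDensityMatrix Γ p q D → D = GeomFock.densityMatrix Γ p q) ∧
    @CompactSpace (GeomFock.State s d N) (GeomFock.geometricTopology s d N) ∧
    @SeqCompactSpace (GeomFock.State s d N) (GeomFock.geometricTopology s d N) ∧
    ∀ Γ : ℕ → GeomFock.State s d N, ∃ (Γ₀ : GeomFock.State s d N) (k : ℕ → ℕ), StrictMono k ∧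
      GeomFock.GeomTendsto (fun n => Γ (k n)) Γ₀ ∧
      ∀ p ≤ N, ∀ q ≤ N,
        GeomFock.WeakStarTendsto (fun n => GeomFock.densityMatrix (Γ (k n)) p q)
          (GeomFock.densityMatrix Γ₀ p q) := by
  refine ⟨fun Γ p _ q _ => ⟨GeomFock.isDensityMatrix_densityMatrix Γ p q, fun D hD =>
      hD.unique (GeomFock.isDensityMatrix_densityMatrix Γ p q)⟩,
    GeomFock.compactSpace_state s d N, GeomFock.seqCompactSpace_state s d N, fun Γ => ?_⟩
  let _ := GeomFock.geometricTopology s d N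
  have := GeomFock.seqCompactSpace_state s d N
  obtain ⟨Γ₀, k, hk, hΓ⟩ := SeqCompactSpace.tendsto_subseq Γ
  have hG := GeomFock.geomTendsto_of_tendsto hΓ
  exact ⟨Γ₀, k, hk, hG, fun p hp q hq => hG.weakStarTendsto hp hq⟩
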